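/- **Setting.** Let $v\ge 3$. A block design with $v$ treatments and $b$ blocks of size $2$ assigns a treatment to each of the two units of each block; it is binary if the two treatments in each block are distinct. Let $N$ be its $v\times b$ treatment-block incidence matrix and let $r_i$ be the replication of treatment $i$. The Laplacian matrix of the design is $2\,\mathrm{diag}(r_1,\dots,r_v)-NN^{T}$. A design is connected if its concurrence graph (vertices are the treatments; distinct $i,j$ are joined by $(NN^T)_{ij}$ edges) is connected. The Laplacian matrix always has the all-ones vector in its kernel; the other $v-1$ eigenvalues $\rho_1,\dots,\rho_{v-1}$ (with multiplicity) are called non-trivial. The $D$-value of a design is $\prod_{i}\rho_i$, and its $A$-value is the harmonic mean $(v-1)/\sum_i \rho_i^{-1}$ (for a connected design all $\rho_i$ are positive). A design is $D$-optimal ($A$-optimal) in a class if it belongs to the class and has the largest $D$-value ($A$-value) in it. Let $\mathcal L(v,v,2)$ be the set of the Laplacian matrices of all binary designs with $v$ treatments and $v$ blocks of size $2$, and let $\mathcal L_1(v,v,2)$ be the set of those $L\in\mathcal L(v,v,2)$ whose sum of non-trivial eigenvalues $S_1$ is maximal over $\mathcal L(v,v,2)$ (since $S_1$ is the same for all binary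 designs, this is all of $\mathcal L(v,v,2)$). For an integer $y\ge 0$ put $L[y]=L+y(vI-J)$, where $J$ is the all-ones matrix; this is the Laplacian matrix of a design obtained from one with Laplacian matrix $L$ by adding blocks of balanced incomplete block designs in which any two treatments occur together in $y$ blocks in total. Let $L(\mathrm{Cycle}(v))$ be the Laplacian matrix of the cycle on $v$ vertices. **Proposition.** Let $v\ge 3$, let $y\ge 0$ be an integer, and let $d$ be a binary design with $v$ treatments and block size $2$ whose Laplacian matrix is $L(\mathrm{Cycle}(v))[y]$. Then $d$ is $D$-optimal, and if $y\ge 1$ also $A$-optimal, among all connected binary designs with block size $2$ whose Laplacian matrix is $L[y]$ for some $L\in\mathcal L_1(v,v,2)$. -/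

import Mathlib

/-- A block design with `v` treatments and `b` blocks of `k` units each: an assignment of a
treatment to every unit of every block. -/
structure BlockDesign (v b k : ℕ) where
  /-- `assign j u` is the treatment applied to unit `u` of block `j`. -/
  assign : Fin b → Fin k → Fin v

namespace BlockDesign

variable {v b k : ℕ}

/-- A design is binary if every treatment occurs at most once in each block. -/
def IsBinary (d : BlockDesign v b k) : Prop :=
  ∀ j : Fin b, Function.Injective (d.assign j)

/-- The treatment-block incidence matrix `N`: the `(i, j)` entry is the number of units of
block `j` that have been assigned treatment `i`. -/
def incidence (d : BlockDesign v b k) : Matrix (Fin v) (Fin b) ℝ :=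
  Matrix.of fun i j => ((Finset.univ.filter fun u : Fin k => d.assign j u = i).card : ℝ)

/-- The replication of treatment `i`: the number of units assigned treatment `i`. -/
def replication (d : BlockDesign v b k) (i : Fin v) : ℝ :=
  ∑ j : Fin b, d.incidence i j

/-- The matrix of concurrences `N Nᵀ`. -/
def concurrence (d : BlockDesign v b k) : Matrix (Fin v) (Fin v) ℝ :=
  d.incidence * d.incidence.transpose

/-- The Laplacian matrix `k diag(r₁, …, r_v) - N Nᵀ` of a design. -/
def laplacian (d : BlockDesign v b k) : Matrix (Fin v) (Fin v) ℝ :=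
  (k : ℝ) • Matrix.diagonal d.replication - d.concurrence

/-- The simple graph underlying the concurrence graph: two distinct treatments are adjacent
when their concurrence is positive. -/
def concurrenceGraph (d : BlockDesign v b k) : SimpleGraph (Fin v) :=
  SimpleGraph.fromRel fun i j => 0 < d.concurrence i j

/-- A design is connected if its concurrence graph is connected. -/
def IsConnected (d : BlockDesign v b k) : Prop :=
  d.concurrenceGraph.Connected

end BlockDesign

/-- The non-trivial eigenvalues of a Laplacian matrix `L`, with multiplicity: all the eigenvalues
except for one eigenvalue `0` (the one of the all-ones vector). -/
noncomputable def nontrivialEigenvalues {v : ℕ} (L : Matrix (Fin v) (Fin v) ℝ) : Multiset ℝ :=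
  L.charpoly.roots.erase 0

/-- `S_j`: the `j`-th elementary symmetric polynomial of the non-trivial eigenvalues. -/
noncomputable def eigenSymm {v : ℕ} (j : ℕ) (L : Matrix (Fin v) (Fin v) ℝ) : ℝ :=
  (nontrivialEigenvalues L).esymm j

/-- The set `𝓛(v, b, k)` of the Laplacian matrices of all binary designs with `v` treatments and
`b` blocks of size `k`. -/
def laplacians (v b k : ℕ) : Set (Matrix (Fin v) (Fin v) ℝ) :=
  {L | ∃ d : BlockDesign v b k, d.IsBinary ∧ d.laplacian = L}

/-- The set `𝓛_i(v, b, k)` of those matrices in `𝓛(v, b, k)` that attain the maximum of `S_j`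
over `𝓛(v, b, k)` for every `j = 1, …, i`. -/
def maxLaplacians (i v b k : ℕ) : Set (Matrix (Fin v) (Fin v) ℝ) :=
  {L | L ∈ laplacians v b k ∧
    ∀ j, 1 ≤ j → j ≤ i → ∀ L' ∈ laplacians v b k, eigenSymm j L' ≤ eigenSymm j L}

/-- `L[y] = L + y (v I - J)`: the Laplacian matrix after the extension of a design with Laplacian
matrix `L` by blocks of balanced incomplete block designs in which any two treatments occur
together in `y` blocks in total. -/
def extendLaplacian {v : ℕ} (L : Matrix (Fin v) (Fin v) ℝ) (y : ℕ) :
    Matrix (Fin v) (Fin v) ℝ :=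
  L + (y : ℝ) • ((v : ℝ) • (1 : Matrix (Fin v) (Fin v) ℝ) - Matrix.of fun _ _ => (1 : ℝ))

namespace BlockDesign

variable {v b k : ℕ}

/-- The `D`-value: the product of the non-trivial Laplacian eigenvalues. -/
noncomputable def dValue (d : BlockDesign v b k) : ℝ :=
  (nontrivialEigenvalues d.laplacian).prod

/-- The `A`-value: the harmonic mean of the `v - 1` non-trivial Laplacian eigenvalues. -/
noncomputable def aValue (d : BlockDesign v b k) : ℝ :=
  ((v : ℝ) - 1) / ((nontrivialEigenvalues d.laplacian).map fun ρ => 1 / ρ).sum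

/-- `d` belongs to the class `P` of designs and maximizes the `D`-value within it. -/
def IsDOptimalAmong (d : BlockDesign v b k) (P : ∀ b' : ℕ, BlockDesign v b' k → Prop) : Prop :=
  P b d ∧ ∀ (b' : ℕ) (d' : BlockDesign v b' k), P b' d' → d'.dValue ≤ d.dValue

/-- `d` belongs to the class `P` of designs and maximizes the `A`-value within it. -/
def IsAOptimalAmong (d : BlockDesign v b k) (P : ∀ b' : ℕ, BlockDesign v b' k → Prop) : Prop :=
  P b d ∧ ∀ (b' : ℕ) (d' : BlockDesign v b' k), P b' d' → d'.aValue ≤ d.aValue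

/-- The connected binary designs whose Laplacian matrix is `L[y]` for some `L` in the set `𝓛`. -/
def IsConnectedExtension (𝓛 : Set (Matrix (Fin v) (Fin v) ℝ)) (y : ℕ)
    (d : BlockDesign v b k) : Prop :=
  d.IsBinary ∧ d.IsConnected ∧ ∃ L ∈ 𝓛, d.laplacian = extendLaplacian L y

end BlockDesign

/-!
Every Laplacian `L` in the class is that of a loopless multigraph with `v` vertices and `v` edges,
and extending the design shifts all non-trivial eigenvalues by `x = y v`
(`nontrivialEigenvalues_extendLaplacian`). So the cycle has to maximize `∏ (x + ρᵢ)`, and for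
`y ≥ 1` to minimize `∑ 1 / (x + ρᵢ)`.

For `y = 0`, write `L = Q Qᵀ` with the square oriented incidence matrix `Q`. The product of the
non-trivial eigenvalues is the sum over the `v` edges of the Gram determinant of the remaining
`v - 1` edges, and by total unimodularity each of these determinants is `0` or `v`
(`det_gram_oriented_incidence`). The product is thus at most `v²`, with equality for the cycle,
where deleting any edge leaves a spanning tree.

For `y ≥ 1`, the inequality for `∑ 1 / (x + λᵢ)` holds at every real `x ≥ v`
(`BlockDesign.sum_one_div_cycleDesign_le`). Let `z = x + 2` and `s = λ - 2`.

* If the multigraph is `2`-regular, it is a union of cycles. The diagonal of the Green function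
  `(x + L)⁻¹` on a cycle of length `k` is `(1 + β ^ k) / ((β⁻¹ - β) (1 - β ^ k))` with
  `β + β⁻¹ = z`, which decreases in `k`, and `k ≤ v`. Instead of decomposing the multigraph into
  cycles, the proof follows the rotation of the flags given by two involutions: go to the other end
  of the block, and change to the other block at the same treatment
  (`BlockDesign.green_ge_of_regular`).
* If it is not `2`-regular and `v ≥ 4`, the first three moments of `s` suffice. By the
  Cauchy–Schwarz inequality `∑ s² / (z + s) ≥ (∑ s²)² / (z ∑ s² + ∑ s³)`, and irregular degrees or
  parallel edges raise `∑ s²` enough to pay for `∑ s³` (`sum_one_div_ge_of_irregular`); for the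
  cycle `|s| ≤ 2`, `∑ s² = 2 v` and `∑ s³ = 0` bound the same sum from above
  (`sum_one_div_le_of_moments`).
* For `v = 3` the triangle has its two non-trivial eigenvalues equal, and convexity is enough.

The inequality for the products at `x ≥ v` follows: the derivative in `x` of
`log ∏ (x + λᵢ)` is `∑ 1 / (x + λᵢ)`, so the difference of these logarithms for the cycle and for
another multigraph decreases on `[v, ∞)`, with limit `0`
(`BlockDesign.prod_add_eigenvalues_le`).
-/

/-! ### Eigenvalues of Laplacian matrices and of their extensions -/

open Polynomial in
/-- Adding a multiple of the all-ones matrix moves the eigenvalue of the all-ones vector only: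
`(X - L) (X - c J) = X (X - L - c J)` since `L J = 0`. -/
lemma charpoly_add_smul_ones {n : ℕ} (L : Matrix (Fin n) (Fin n) ℝ)
    (hL : ∀ i, ∑ j, L i j = 0) (c : ℝ) (hn : 0 < n) :
    X * (L + c • Matrix.of fun _ _ => (1 : ℝ)).charpoly = (X - C (c * n)) * L.charpoly := by
  set J : Matrix (Fin n) (Fin n) ℝ := Matrix.of fun _ _ => (1 : ℝ)
  have hJ : (c • J).charpoly = X ^ (n - 1) * (X - C (c * n)) := by
    have h : c • J = Matrix.vecMulVec (fun _ => c) (fun _ => 1) := by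
      ext i j; simp [J, Matrix.vecMulVec_apply]
    rw [h, Matrix.charpoly_vecMulVec]
    obtain ⟨m, rfl⟩ : ∃ m, n = m + 1 := ⟨n - 1, by omega⟩
    simp [dotProduct, pow_succ, mul_sub, Polynomial.smul_eq_C_mul]
    ring
  have hmul : L * (c • J) = 0 := by
    ext i j
    simp [Matrix.mul_apply, J, ← Finset.sum_mul, hL]
  have key : Matrix.charmatrix L * Matrix.charmatrix (c • J)
      = (X : ℝ[X]) • Matrix.charmatrix (L + c • J) := by
    simp only [Matrix.charmatrix, RingHom.mapMatrix_apply]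
    have h0 : L.map (C : ℝ → ℝ[X]) * (c • J).map C = 0 := by
      rw [← Matrix.map_mul, hmul]; ext i j; simp
    have hX : Matrix.scalar (Fin n) (X : ℝ[X]) = (X : ℝ[X]) • 1 := by
      rw [Matrix.smul_one_eq_diagonal]; rfl
    have ha : (L + c • J).map (C : ℝ → ℝ[X]) = L.map C + (c • J).map C := by
      ext i j; simp
    rw [sub_mul, mul_sub, mul_sub, h0, ha, hX]
    simp only [smul_mul_assoc, mul_smul_comm, one_mul, mul_one, smul_sub, smul_add]
    abel
  have hdet := congrArg Matrix.det key
  rw [Matrix.det_mul, Matrix.det_smul] at hdet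
  change L.charpoly * (c • J).charpoly = X ^ _ * (L + c • J).charpoly at hdet
  rw [hJ, Fintype.card_fin] at hdet
  obtain ⟨m, rfl⟩ : ∃ m, n = m + 1 := ⟨n - 1, by omega⟩
  have hXm : (X : ℝ[X]) ^ m ≠ 0 := pow_ne_zero _ X_ne_zero
  apply mul_left_cancel₀ hXm
  simp only [Nat.add_sub_cancel] at hdet
  linear_combination -hdet

open Polynomial in
lemma roots_charpoly_add_smul_one {n : ℕ} (M : Matrix (Fin n) (Fin n) ℝ) (c : ℝ) :
    (M + c • (1 : Matrix (Fin n) (Fin n) ℝ)).charpoly.roots = M.charpoly.roots.map (· + c) := by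
  have h : M + c • (1 : Matrix (Fin n) (Fin n) ℝ) = M - Matrix.scalar (Fin n) (-c) := by
    rw [Matrix.smul_one_eq_diagonal]
    ext i j; simp [Matrix.diagonal_apply]; split_ifs <;> simp
  rw [h, Matrix.charpoly_sub_scalar]
  have := M.charpoly.roots_comp_C_mul_X_add_C 1 (-c) isUnit_one
  simpa [add_comm] using this

/-- The all-ones vector accounts for one eigenvalue `0`, the one erased in
`nontrivialEigenvalues`. -/
lemma cons_nontrivialEigenvalues {n : ℕ} (hn : 0 < n) {L : Matrix (Fin n) (Fin n) ℝ}
    (hL : ∀ i, ∑ j, L i j = 0) : 0 ::ₘ nontrivialEigenvalues L = L.charpoly.roots := by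
  refine Multiset.cons_erase ?_
  rw [Polynomial.mem_roots (Matrix.charpoly_monic L).ne_zero,
    ← Matrix.mem_spectrum_iff_isRoot_charpoly, spectrum.zero_mem_iff,
    Matrix.isUnit_iff_isUnit_det, isUnit_iff_ne_zero, not_not,
    ← Matrix.exists_mulVec_eq_zero_iff]
  refine ⟨fun _ => 1, fun h => ?_, ?_⟩
  · simpa using congrFun h ⟨0, hn⟩
  · ext i; simp [Matrix.mulVec, dotProduct, hL]

open Polynomial in
/-- Extending a design shifts every non-trivial eigenvalue by `y v`. -/
lemma nontrivialEigenvalues_extendLaplacian {n : ℕ} (hn : 0 < n) {L : Matrix (Fin n) (Fin n) ℝ}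
    (hL : ∀ i, ∑ j, L i j = 0) (y : ℕ) :
    nontrivialEigenvalues (extendLaplacian L y)
      = (nontrivialEigenvalues L).map (· + (y : ℝ) * n) := by
  set M := L + (-(y : ℝ)) • Matrix.of fun (_ _ : Fin n) => (1 : ℝ) with hM
  have h1 : extendLaplacian L y = M + ((y : ℝ) * n) • 1 := by
    rw [extendLaplacian, hM, smul_sub, smul_smul]; simp only [neg_smul]; abel
  have h2 : M.charpoly.roots = -((y : ℝ) * n) ::ₘ nontrivialEigenvalues L := by
    have hp := congrArg roots (charpoly_add_smul_ones L hL (-(y : ℝ)) hn)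
    rw [← hM, roots_mul (mul_ne_zero X_ne_zero M.charpoly_monic.ne_zero),
      roots_mul (mul_ne_zero (X_sub_C_ne_zero _) L.charpoly_monic.ne_zero),
      ← cons_nontrivialEigenvalues hn hL, roots_X, roots_X_sub_C] at hp
    rw [Multiset.singleton_add, Multiset.singleton_add, Multiset.cons_swap,
      Multiset.cons_inj_right] at hp
    rw [hp]; simp
  rw [nontrivialEigenvalues, h1, roots_charpoly_add_smul_one, h2]
  simp

namespace Matrix.IsHermitian

variable {n : ℕ} {M : Matrix (Fin n) (Fin n) ℝ} (hM : M.IsHermitian)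
include hM

lemma trace_add_smul_one_pow (c : ℝ) (k : ℕ) :
    ((M + c • (1 : Matrix (Fin n) (Fin n) ℝ)) ^ k).trace = ∑ i, (hM.eigenvalues i + c) ^ k := by
  set φ := Unitary.conjStarAlgAut ℝ (Matrix (Fin n) (Fin n) ℝ) hM.eigenvectorUnitary with hφ
  have h1 : M + c • (1 : Matrix (Fin n) (Fin n) ℝ)
      = φ (Matrix.diagonal fun i => hM.eigenvalues i + c) := by
    have h : (Matrix.diagonal fun i => hM.eigenvalues i + c)
        = Matrix.diagonal (RCLike.ofReal ∘ hM.eigenvalues) + c • (1 : Matrix (Fin n) (Fin n) ℝ) := by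
      rw [Matrix.smul_one_eq_diagonal, Matrix.diagonal_add]; rfl
    rw [h, map_add, map_smul, map_one, ← hM.spectral_theorem]
  rw [h1, ← map_pow, Matrix.diagonal_pow, Unitary.conjStarAlgAut_apply, Matrix.trace_mul_cycle]
  simp [Matrix.trace_diagonal]

/-- The trace of the resolvent; `G` is the inverse of `M + x`. -/
lemma trace_eq_sum_one_div {x : ℝ} (hx : ∀ i, x + hM.eigenvalues i ≠ 0)
    {G : Matrix (Fin n) (Fin n) ℝ} (hG : (M + x • (1 : Matrix (Fin n) (Fin n) ℝ)) * G = 1) :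
    G.trace = ∑ i, 1 / (x + hM.eigenvalues i) := by
  set φ := Unitary.conjStarAlgAut ℝ (Matrix (Fin n) (Fin n) ℝ) hM.eigenvectorUnitary with hφ
  have h1 : M + x • (1 : Matrix (Fin n) (Fin n) ℝ)
      = φ (Matrix.diagonal fun i => x + hM.eigenvalues i) := by
    have h : (Matrix.diagonal fun i => x + hM.eigenvalues i)
        = Matrix.diagonal (RCLike.ofReal ∘ hM.eigenvalues) + x • (1 : Matrix (Fin n) (Fin n) ℝ) := by
      rw [Matrix.smul_one_eq_diagonal, Matrix.diagonal_add]
      congr 1; ext i; exact add_comm _ _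
    rw [h, map_add, map_smul, map_one, ← hM.spectral_theorem]
  have h2 : φ (Matrix.diagonal fun i => 1 / (x + hM.eigenvalues i))
      * (M + x • (1 : Matrix (Fin n) (Fin n) ℝ)) = 1 := by
    rw [h1, ← map_mul, Matrix.diagonal_mul_diagonal]
    have : (Matrix.diagonal fun i => 1 / (x + hM.eigenvalues i) * (x + hM.eigenvalues i))
        = (1 : Matrix (Fin n) (Fin n) ℝ) := by
      rw [← Matrix.diagonal_one]; congr 1; ext i; exact one_div_mul_cancel (hx i)
    rw [this, map_one]
  have h3 : G = φ (Matrix.diagonal fun i => 1 / (x + hM.eigenvalues i)) := by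
    rw [← one_mul G, ← h2, mul_assoc, hG, mul_one]
  rw [h3, Unitary.conjStarAlgAut_apply, Matrix.trace_mul_cycle]
  simp [Matrix.trace_diagonal]

lemma cons_nontrivialEigenvalues (hn : 0 < n) (h : ∀ i, ∑ j, M i j = 0) :
    0 ::ₘ nontrivialEigenvalues M = Finset.univ.val.map hM.eigenvalues := by
  rw [_root_.cons_nontrivialEigenvalues hn h, hM.roots_charpoly_eq_eigenvalues]
  rfl

end Matrix.IsHermitian

/-! ### Spanning trees and the product of the non-trivial eigenvalues -/

/-- The oriented incidence vectors of a multigraph form a totally unimodular matrix: column `j` is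
`e_{a j} - e_{b j}`, and `f` selects the rows of a square submatrix. -/
lemma det_oriented_incidence_mem {ι : Type*} [DecidableEq ι] (n : ℕ) (f : Fin n → ι)
    (hf : Function.Injective f) (a b : Fin n → ι) :
    (Matrix.of fun i j : Fin n =>
      ((if a j = f i then 1 else 0) - (if b j = f i then 1 else 0) : ℝ)).det ∈
      ({0, 1, -1} : Set ℝ) := by
  induction n with
  | zero => simp
  | succ n ih =>
    set M : Matrix (Fin (n + 1)) (Fin (n + 1)) ℝ := Matrix.of fun i j =>
      ((if a j = f i then 1 else 0) - (if b j = f i then 1 else 0) : ℝ) with hM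
    -- a column with a single nonzero entry allows a Laplace expansion
    have expand : ∀ (j i₀ : Fin (n + 1)) (c : ℝ), c = 1 ∨ c = -1 →
        (∀ i, M i j = if i = i₀ then c else 0) → M.det ∈ ({0, 1, -1} : Set ℝ) := by
      intro j i₀ c hc hcol
      have hd := Matrix.det_succ_column M j
      rw [Finset.sum_eq_single i₀ (fun i _ hi => by rw [hcol, if_neg hi]; ring) (by simp),
        hcol, if_pos rfl] at hd
      have hs := ih (f ∘ i₀.succAbove) (hf.comp Fin.succAbove_right_injective)
        (a ∘ j.succAbove) (b ∘ j.succAbove)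
      have he : M.submatrix i₀.succAbove j.succAbove = Matrix.of fun i k : Fin n =>
          ((if (a ∘ j.succAbove) k = (f ∘ i₀.succAbove) i then 1 else 0)
            - (if (b ∘ j.succAbove) k = (f ∘ i₀.succAbove) i then 1 else 0) : ℝ) := by
        ext i k; simp [hM]
      rw [← he] at hs
      rw [hd]
      rcases neg_one_pow_eq_or ℝ ((i₀ : ℕ) + j) with h1 | h1 <;> rw [h1] <;>
      rcases hc with rfl | rfl <;>
      simp only [Set.mem_insert_iff, Set.mem_singleton_iff] at hs ⊢ <;>
      rcases hs with hs | hs | hs <;> rw [hs] <;> norm_num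
    by_cases h : ∀ j, ((∃ i, a j = f i) ↔ ∃ i, b j = f i)
    · left
      rw [← Matrix.exists_vecMul_eq_zero_iff]
      refine ⟨fun _ => 1, fun h0 => by simpa using congrFun h0 0, ?_⟩
      ext j
      have hsum : ∀ c : ι, ∑ i, (if c = f i then (1 : ℝ) else 0)
          = if ∃ i, c = f i then 1 else 0 := by
        intro c
        split_ifs with hc
        · obtain ⟨i, rfl⟩ := hc
          simp [hf.eq_iff]
        · push Not at hc
          simp [hc]
      simp only [Matrix.vecMul, dotProduct, one_mul, hM, Matrix.of_apply, Finset.sum_sub_distrib,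
        hsum, h j, sub_self, Pi.zero_apply]
    · push Not at h
      obtain ⟨j, ⟨⟨i₀, h1⟩, h2⟩ | ⟨h2, ⟨i₀, h1⟩⟩⟩ := h
      · refine expand j i₀ 1 (Or.inl rfl) fun i => ?_
        simp only [hM, Matrix.of_apply, h1, h2 i, hf.eq_iff, if_false, sub_zero, @eq_comm _ i₀]
      · refine expand j i₀ (-1) (Or.inr rfl) fun i => ?_
        simp only [hM, Matrix.of_apply, h1, h2 i, hf.eq_iff, if_false, zero_sub, @eq_comm _ i₀]
        split_ifs <;> simp

/-- The Gram determinant of `n` oriented edges on `n + 1` vertices is `n + 1` when they form a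
spanning tree and `0` otherwise. -/
lemma det_gram_oriented_incidence {n : ℕ} (a b : Fin n → Fin (n + 1))
    {Q : Matrix (Fin (n + 1)) (Fin n) ℝ}
    (hQ : ∀ i j, Q i j = (if a j = i then 1 else 0) - (if b j = i then 1 else 0)) :
    (Q.transpose * Q).det = 0 ∨ (Q.transpose * Q).det = n + 1 := by
  have hcol : ∀ j, ∑ i, Q i j = 0 := fun j => by simp [hQ]
  set R : Matrix (Fin (n + 1)) (Fin (n + 1)) ℝ := Matrix.of fun i => Fin.cons 1 (Q i) with hR
  -- adding all rows of `R` to the top one leaves `(n + 1, 0, …, 0)` there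
  have hR1 : R.det = (n + 1) * (Matrix.of fun i j : Fin n =>
      ((if a j = i.succ then 1 else 0) - (if b j = i.succ then 1 else 0) : ℝ)).det := by
    have h := Matrix.det_updateRow_sum R 0 (fun _ => 1)
    rw [one_smul] at h
    rw [← h, Matrix.det_succ_row_zero, Fin.sum_univ_succ]
    have hz : ∀ k : Fin n, (∑ i, (1 : ℝ) • R i) k.succ = 0 := fun k => by
      refine (Finset.sum_apply _ _ _).trans ?_
      simpa [hR] using hcol k
    have h0 : (∑ i, (1 : ℝ) • R i) 0 = (n : ℝ) + 1 := by
      refine (Finset.sum_apply _ _ _).trans ?_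
      simp [hR]
    simp only [Matrix.updateRow_self, hz, h0]
    simp only [mul_zero, zero_mul, Finset.sum_const_zero, add_zero, Fin.val_zero, pow_zero, one_mul]
    congr 2
    ext i j
    simp [Matrix.submatrix_apply, Matrix.updateRow_ne, hR, hQ]
  have hR2 : R.det ^ 2 = (n + 1) * (Q.transpose * Q).det := by
    have h1 : R.det ^ 2 = (R.transpose * R).det := by
      rw [Matrix.det_mul, Matrix.det_transpose, sq]
    rw [h1, Matrix.det_succ_row_zero, Fin.sum_univ_succ]
    have hz : ∀ k : Fin n, (R.transpose * R) 0 k.succ = 0 := fun k => by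
      simp [Matrix.mul_apply, hR, hcol]
    have h0 : (R.transpose * R) 0 0 = (n : ℝ) + 1 := by
      simp [Matrix.mul_apply, hR]
    simp only [hz, h0]
    simp only [mul_zero, zero_mul, Finset.sum_const_zero, add_zero, Fin.val_zero, pow_zero, one_mul]
    congr 2
  have hn : (n : ℝ) + 1 ≠ 0 := by positivity
  rcases det_oriented_incidence_mem n Fin.succ (Fin.succ_injective n) a b with h | h | h <;>
    rw [hR1] at hR2 <;> rw [h] at hR2
  · left
    have := hR2.symm
    simpa [hn] using this
  · right; apply mul_left_cancel₀ hn; linear_combination -hR2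
  · right; apply mul_left_cancel₀ hn; linear_combination -hR2

open Polynomial in
lemma prod_nontrivialEigenvalues_eq_coeff {n : ℕ} {L : Matrix (Fin (n + 1)) (Fin (n + 1)) ℝ}
    (hL : L.IsHermitian) (h0 : ∀ i, ∑ j, L i j = 0) :
    (nontrivialEigenvalues L).prod = (-1) ^ n * L.charpoly.coeff 1 := by
  have hroots := cons_nontrivialEigenvalues n.succ_pos h0
  have hcard : (nontrivialEigenvalues L).card = n := by
    have := congrArg Multiset.card (hL.cons_nontrivialEigenvalues n.succ_pos h0)
    simpa using this
  have hprod : L.charpoly = X * ((nontrivialEigenvalues L).map fun t => X - C t).prod := by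
    have h := hL.splits_charpoly.eq_prod_roots_of_monic L.charpoly_monic
    rw [← hroots] at h
    simpa using h
  rw [hprod, coeff_X_mul, Multiset.prod_X_sub_C_coeff _ (Nat.zero_le _), hcard, Nat.sub_zero,
    ← mul_assoc, ← mul_pow]
  simp [← hcard, Multiset.esymm, Multiset.powersetCard_self]

/-- The product of the non-trivial eigenvalues is, up to sign, the linear coefficient of the
characteristic polynomial, and `Q Qᵀ` and `Qᵀ Q` share this polynomial. The sum runs over the sets
of all edges but one. -/
lemma prod_nontrivialEigenvalues_mul_transpose {n : ℕ}
    (Q : Matrix (Fin (n + 1)) (Fin (n + 1)) ℝ) (h0 : ∀ j, ∑ i, Q i j = 0) :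
    (nontrivialEigenvalues (Q * Q.transpose)).prod =
      ∑ s ∈ Finset.powersetCard n (Finset.univ : Finset (Fin (n + 1))),
        ((Q.transpose * Q).submatrix (Subtype.val : s → _) Subtype.val).det := by
  have hH : (Q * Q.transpose).IsHermitian := by
    simpa using Matrix.isHermitian_mul_conjTranspose_self Q
  have hrow : ∀ i, ∑ j, (Q * Q.transpose) i j = 0 := fun i => by
    simp only [Matrix.mul_apply, Matrix.transpose_apply]
    rw [Finset.sum_comm]
    simp [← Finset.mul_sum, h0]
  rw [prod_nontrivialEigenvalues_eq_coeff hH hrow, Matrix.charpoly_mul_comm]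
  have h := Matrix.charpoly_coeff_eq_sum_minors (Q.transpose * Q) n (by simp)
  rw [Fintype.card_fin, Nat.add_sub_cancel_left] at h
  rw [h, ← mul_assoc, ← mul_pow]
  simp

/-- A principal minor of order `n` of the edge matrix `Qᵀ Q` is a Gram determinant of `n` edges. -/
lemma minor_eq_det_gram {n : ℕ} (Q : Matrix (Fin (n + 1)) (Fin (n + 1)) ℝ)
    (s : Finset (Fin (n + 1))) (hs : s.card = n) :
    ((Q.transpose * Q).submatrix (Subtype.val : s → _) Subtype.val).det =
      ((Q.submatrix id (s.orderEmbOfFin hs)).transpose *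
        Q.submatrix id (s.orderEmbOfFin hs)).det := by
  rw [← Matrix.det_submatrix_equiv_self (s.orderIsoOfFin hs).toEquiv]
  congr 1

lemma prod_nontrivialEigenvalues_le {n : ℕ} (a b : Fin (n + 1) → Fin (n + 1))
    {Q : Matrix (Fin (n + 1)) (Fin (n + 1)) ℝ}
    (hQ : ∀ i j, Q i j = (if a j = i then 1 else 0) - (if b j = i then 1 else 0)) :
    (nontrivialEigenvalues (Q * Q.transpose)).prod ≤ ((n : ℝ) + 1) ^ 2 := by
  rw [prod_nontrivialEigenvalues_mul_transpose Q (fun j => by simp [hQ])]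
  have hle : ∀ s ∈ Finset.powersetCard n (Finset.univ : Finset (Fin (n + 1))),
      ((Q.transpose * Q).submatrix (Subtype.val : s → _) Subtype.val).det ≤ (n : ℝ) + 1 := by
    intro s hs
    have hs' := (Finset.mem_powersetCard.mp hs).2
    rw [minor_eq_det_gram Q s hs']
    rcases det_gram_oriented_incidence (a ∘ s.orderEmbOfFin hs') (b ∘ s.orderEmbOfFin hs')
      (Q := Q.submatrix id (s.orderEmbOfFin hs')) (fun i j => by simp [hQ]) with h | h <;> rw [h]
    positivity
  refine (Finset.sum_le_card_nsmul _ _ _ hle).trans ?_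
  simp [Finset.card_powersetCard, sq, mul_add]

/-- If deleting any edge leaves independent edges, every deletion gives a spanning tree. -/
lemma prod_nontrivialEigenvalues_eq {n : ℕ} (a b : Fin (n + 1) → Fin (n + 1))
    {Q : Matrix (Fin (n + 1)) (Fin (n + 1)) ℝ}
    (hQ : ∀ i j, Q i j = (if a j = i then 1 else 0) - (if b j = i then 1 else 0))
    (hker : ∀ w : Fin (n + 1) → ℝ, Q.mulVec w = 0 → ∀ e, w e = 0 → w = 0) :
    (nontrivialEigenvalues (Q * Q.transpose)).prod = ((n : ℝ) + 1) ^ 2 := by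
  rw [prod_nontrivialEigenvalues_mul_transpose Q (fun j => by simp [hQ])]
  have hle : ∀ s ∈ Finset.powersetCard n (Finset.univ : Finset (Fin (n + 1))),
      ((Q.transpose * Q).submatrix (Subtype.val : s → _) Subtype.val).det = (n : ℝ) + 1 := by
    intro s hs
    have hs' := (Finset.mem_powersetCard.mp hs).2
    rw [minor_eq_det_gram Q s hs']
    rcases det_gram_oriented_incidence (a ∘ s.orderEmbOfFin hs') (b ∘ s.orderEmbOfFin hs')
      (Q := Q.submatrix id (s.orderEmbOfFin hs')) (fun i j => by simp [hQ]) with h | h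
    swap
    · exact h
    exfalso
    obtain ⟨w, hw0, hw⟩ := Matrix.exists_mulVec_eq_zero_iff.mpr h
    have hw' : (Q.submatrix id (s.orderEmbOfFin hs')).mulVec w = 0 := by
      have := (Matrix.conjTranspose_mul_self_mulVec_eq_zero
        (Q.submatrix id (s.orderEmbOfFin hs')) w).mp
      exact this (by simpa using hw)
    -- a dependency among the edges of `s`, extended by zero, is a kernel vector vanishing at `e`
    obtain ⟨e, he⟩ : ∃ e, e ∉ s := by
      by_contra hc
      push Not at hc
      have : s = Finset.univ := Finset.eq_univ_of_forall hc
      rw [this] at hs'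
      simp at hs'
    have hinj : Function.Injective (s.orderEmbOfFin hs') := (s.orderEmbOfFin hs').injective
    have hext : Function.extend (s.orderEmbOfFin hs') w 0 = 0 := by
      refine hker _ ?_ e ?_
      · ext i
        have hwi := congrFun hw' i
        simp only [Matrix.mulVec, dotProduct, Matrix.submatrix_apply, id] at hwi ⊢
        rw [← hwi, ← Finset.sum_subset (Finset.subset_univ
          (Finset.univ.image (s.orderEmbOfFin hs'))), Finset.sum_image hinj.injOn]
        · simp [hinj.extend_apply]
        · intro j _ hj
          rw [Finset.image_orderEmbOfFin_univ] at hj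
          rw [Function.extend_apply', Pi.zero_apply, mul_zero]
          rintro ⟨k, rfl⟩
          exact hj (s.orderEmbOfFin_mem hs' k)
      · rw [Function.extend_apply', Pi.zero_apply]
        rintro ⟨k, rfl⟩
        exact he (s.orderEmbOfFin_mem hs' k)
    apply hw0
    ext k
    rw [← hinj.extend_apply w 0 k, hext]; rfl
  rw [Finset.sum_congr rfl hle]
  simp [Finset.card_powersetCard, sq, mul_add]

/-! ### Moments of the eigenvalues and irregular multigraphs -/

section Traces
variable {n : ℕ} (d : Fin n → ℝ) (A : Matrix (Fin n) (Fin n) ℝ)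

lemma trace_diagonal_mul_eq_sum (M : Matrix (Fin n) (Fin n) ℝ) :
    (Matrix.diagonal d * M).trace = ∑ i, d i * M i i := by
  simp [Matrix.trace, Matrix.diagonal_mul]

lemma trace_diagonal_sub_sq (hA : ∀ i, A i i = 0) :
    ((Matrix.diagonal d - A) ^ 2).trace = ∑ i, d i ^ 2 + ∑ i, (A * A) i i := by
  have h1 : (Matrix.diagonal d - A) ^ 2 = Matrix.diagonal d * Matrix.diagonal d
      - Matrix.diagonal d * A - A * Matrix.diagonal d + A * A := by noncomm_ring
  rw [h1]
  simp only [Matrix.trace_add, Matrix.trace_sub, Matrix.trace_mul_comm A (Matrix.diagonal d),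
    trace_diagonal_mul_eq_sum, hA, Matrix.diagonal_apply_eq]
  simp [Matrix.trace, sq]

lemma trace_diagonal_sub_cube (hA : ∀ i, A i i = 0) :
    ((Matrix.diagonal d - A) ^ 3).trace
      = ∑ i, d i ^ 3 + 3 * ∑ i, d i * (A * A) i i - (A * A * A).trace := by
  set Δ := Matrix.diagonal d with hΔ
  have h1 : (Δ - A) ^ 3 = Δ * (Δ * Δ) - Δ * (Δ * A) - Δ * A * Δ - A * (Δ * Δ)
      + Δ * (A * A) + A * Δ * A + A * A * Δ - A * A * A := by
    noncomm_ring
  have h2 : (Δ * A * Δ).trace = (Δ * (Δ * A)).trace := Matrix.trace_mul_comm _ _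
  have h3 : (A * (Δ * Δ)).trace = (Δ * (Δ * A)).trace := by
    rw [Matrix.trace_mul_comm, mul_assoc]
  have h4 : (A * Δ * A).trace = (Δ * (A * A)).trace := by
    rw [mul_assoc, Matrix.trace_mul_comm, mul_assoc]
  have h5 : (A * A * Δ).trace = (Δ * (A * A)).trace := Matrix.trace_mul_comm _ _
  rw [h1]
  simp only [Matrix.trace_add, Matrix.trace_sub, h2, h3, h4, h5]
  have h6 : (Δ * (Δ * A)).trace = 0 := by
    rw [hΔ, trace_diagonal_mul_eq_sum]; simp [Matrix.diagonal_mul, hA]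
  have h7 : (Δ * (Δ * Δ)).trace = ∑ i, d i ^ 3 := by
    rw [hΔ, trace_diagonal_mul_eq_sum]
    simp [pow_succ, mul_assoc]
  have h8 : (Δ * (A * A)).trace = ∑ i, d i * (A * A) i i := trace_diagonal_mul_eq_sum d _
  rw [h6, h7, h8]; ring

end Traces

/-- The polynomial inequality behind the irregular case; the three substitutions of
`D`, `v` and `Q` by nonnegative slacks make every coefficient of the difference nonnegative. -/
lemma irregular_polynomial_bound {v D : ℕ} {Q : ℝ} (hv : 4 ≤ v) (hD : 1 ≤ D) (hDv : D + 2 ≤ v)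
    (hQ : (D : ℝ) ^ 2 + D ≤ Q) :
    (2 * v + 1) * (3 * D * Q) ≤ (v + 2) * (2 * v + Q) * (Q - 1) := by
  obtain ⟨w, hw, rfl⟩ : ∃ w : ℝ, 0 ≤ w ∧ Q = (D : ℝ) ^ 2 + D + w :=
    ⟨Q - ((D : ℝ) ^ 2 + D), by linarith, by ring⟩
  rw [← sub_nonneg]
  obtain rfl | hD2 := hD.eq_or_lt
  · obtain ⟨t, rfl⟩ := Nat.exists_eq_add_of_le hv
    push_cast
    ring_nf
    positivity
  · obtain ⟨u, rfl⟩ := Nat.exists_eq_add_of_le (show 2 ≤ D from hD2)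
    obtain ⟨t, rfl⟩ := Nat.exists_eq_add_of_le hDv
    push_cast
    ring_nf
    positivity

/-- Cauchy–Schwarz applied to `1 / (z + s) = 1 / z - s / z² + s² / (z² (z + s))`. -/
lemma sum_one_div_ge_of_moments {ι : Type*} [Fintype ι] {s : ι → ℝ} {z T₂ T₃ : ℝ} (hz : 0 < z)
    (hs : ∀ i, 0 < z + s i) (h1 : ∑ i, s i = 0) (h2 : ∑ i, s i ^ 2 = T₂)
    (h3 : ∑ i, s i ^ 3 = T₃) {C : ℝ} (hC : C * (z * T₂ + T₃) ≤ T₂ ^ 2) (hT : 0 < T₂) :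
    Fintype.card ι / z + C / z ^ 2 ≤ ∑ i, 1 / (z + s i) := by
  have hid : ∀ i, 1 / (z + s i) = 1 / z - s i / z ^ 2 + 1 / z ^ 2 * (s i ^ 2 / (z + s i)) := by
    intro i
    have := (hs i).ne'
    field_simp
    ring
  have hW : C ≤ ∑ i, s i ^ 2 / (z + s i) := by
    have hcs := Finset.sum_sq_le_sum_mul_sum_of_sq_le_mul Finset.univ (r := fun i => s i ^ 2)
      (f := fun i => s i ^ 2 / (z + s i)) (g := fun i => s i ^ 2 * (z + s i))
      (fun i _ => div_nonneg (sq_nonneg _) (hs i).le)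
      (fun i _ => mul_nonneg (sq_nonneg _) (hs i).le)
      (fun i _ => by have := (hs i).ne'; apply le_of_eq; field_simp)
    have hg : ∑ i, s i ^ 2 * (z + s i) = z * T₂ + T₃ := by
      rw [← h2, ← h3, Finset.mul_sum, ← Finset.sum_add_distrib]
      exact Finset.sum_congr rfl fun i _ => by ring
    rw [hg, h2] at hcs
    have hW0 : 0 ≤ ∑ i, s i ^ 2 / (z + s i) :=
      Finset.sum_nonneg fun i _ => div_nonneg (sq_nonneg _) (hs i).le
    have hg0 : 0 ≤ z * T₂ + T₃ :=
      hg ▸ Finset.sum_nonneg fun i _ => mul_nonneg (sq_nonneg _) (hs i).le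
    have hgpos : 0 < z * T₂ + T₃ := by
      rcases hg0.eq_or_lt with h | h
      · rw [← h] at hcs; nlinarith [pow_pos hT 2]
      · exact h
    exact le_of_mul_le_mul_right (hC.trans hcs) hgpos
  rw [Finset.sum_congr rfl fun i _ => hid i, Finset.sum_add_distrib, Finset.sum_sub_distrib,
    ← Finset.sum_div _ s, h1, ← Finset.mul_sum]
  have : 1 / z ^ 2 * C ≤ 1 / z ^ 2 * ∑ i, s i ^ 2 / (z + s i) :=
    mul_le_mul_of_nonneg_left hW (by positivity)
  simp only [Finset.sum_const, Finset.card_univ, nsmul_eq_mul, zero_div, sub_zero]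
  calc _ = Fintype.card ι * (1 / z) + 1 / z ^ 2 * C := by ring
    _ ≤ _ := by linarith

/-- The opposite estimate when `|s| ≤ 2`, from `s⁴ / (z + s) ≤ 4 s² (z - s) / (z² - 4)`. -/
lemma sum_one_div_le_of_moments {ι : Type*} [Fintype ι] {s : ι → ℝ} {z : ℝ} (hz : 2 < z)
    (hs : ∀ i, |s i| ≤ 2) (h1 : ∑ i, s i = 0) (h2 : ∑ i, s i ^ 2 = 2 * Fintype.card ι)
    (h3 : ∑ i, s i ^ 3 = 0) :
    ∑ i, 1 / (z + s i) ≤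
      Fintype.card ι / z + (2 * Fintype.card ι / z +
        8 * Fintype.card ι / (z * (z ^ 2 - 4))) / z ^ 2 := by
  have hz4 : 0 < z ^ 2 - 4 := by nlinarith
  have hz0 : 0 < z := by linarith
  have hb : ∀ i, 1 / (z + s i) ≤ 1 / z - s i / z ^ 2 + s i ^ 2 / z ^ 3 - s i ^ 3 / z ^ 4
      + (4 * z * s i ^ 2 - 4 * s i ^ 3) / (z ^ 4 * (z ^ 2 - 4)) := by
    intro i
    obtain ⟨hl, hu⟩ := abs_le.mp (hs i)
    have hzs : 0 < z + s i := by linarith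
    have hid : 1 / (z + s i) = 1 / z - s i / z ^ 2 + s i ^ 2 / z ^ 3 - s i ^ 3 / z ^ 4
        + s i ^ 4 / (z ^ 4 * (z + s i)) := by
      have := hzs.ne'
      field_simp
      ring
    rw [hid]
    refine add_le_add_right ?_ _
    rw [div_le_div_iff₀ (by positivity) (by positivity)]
    have h4 : s i ^ 2 ≤ 4 := by nlinarith
    have : 0 ≤ z ^ 4 * (s i ^ 2 * (z ^ 2 * (4 - s i ^ 2))) := by
      have : 0 ≤ 4 - s i ^ 2 := by linarith
      positivity
    nlinarith
  refine (Finset.sum_le_sum fun i _ => hb i).trans (le_of_eq ?_)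
  simp only [Finset.sum_add_distrib, Finset.sum_sub_distrib, ← Finset.sum_div, ← Finset.mul_sum,
    h1, h2, h3]
  simp only [Finset.sum_const, Finset.card_univ, nsmul_eq_mul]
  field_simp
  ring

/-- A multigraph with as many edges as vertices that is not `2`-regular: the moments of its
Laplacian eigenvalues force a large sum of reciprocals. Here `A i j` is the number of edges between
`i` and `j`, and `∑ j, A i j` is the degree of `i`. -/
lemma sum_one_div_ge_of_irregular {v : ℕ} (hv : 4 ≤ v) (A : Matrix (Fin v) (Fin v) ℕ)
    (hA : ∀ i, A i i = 0) (hdeg : ∀ i, ∑ j, A i j ≤ v) (hsym : ∀ i j, A i j = A j i)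
    (hedges : ∑ i, ∑ j, A i j = 2 * v) (hirr : ∃ i, ∑ j, A i j ≠ 2)
    {L : Matrix (Fin v) (Fin v) ℝ} (hL : L.IsHermitian)
    (hLA : L = Matrix.diagonal (fun i => ((∑ j, A i j : ℕ) : ℝ)) - A.map (Nat.cast : ℕ → ℝ))
    (hpos : ∀ i, 0 ≤ hL.eigenvalues i) {x : ℝ} (hx : v ≤ x) :
    v / (x + 2) + ((2 * v + 1) / (x + 2)) / (x + 2) ^ 2 ≤ ∑ i, 1 / (x + hL.eigenvalues i) := by
  have hvr : (4 : ℝ) ≤ v := by exact_mod_cast hv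
  -- `d i` is the excess of the degree of `i` over `2`, and `D` is its maximum
  set d : Fin v → ℤ := fun i => (∑ j, A i j : ℕ) - 2 with hd
  set B : Matrix (Fin v) (Fin v) ℝ := A.map (Nat.cast : ℕ → ℝ) with hB
  have hB0 : ∀ i, B i i = 0 := fun i => by simp [hB, hA]
  have hdsum : ∑ i, d i = 0 := by
    simp only [hd, Finset.sum_sub_distrib, Finset.sum_const, Finset.card_univ, Fintype.card_fin]
    rw [← Nat.cast_sum, hedges]; push_cast; simp; ring
  have : Nonempty (Fin v) := ⟨⟨0, by omega⟩⟩
  obtain ⟨i₀, -, hmax⟩ := Finset.exists_max_image Finset.univ d Finset.univ_nonempty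
  have hD1 : 1 ≤ d i₀ := by
    by_contra hlt
    have hle : ∀ i ∈ Finset.univ, d i ≤ 0 := fun i hi => (hmax i hi).trans (by omega)
    obtain ⟨i, hi⟩ := hirr
    have := (Finset.sum_eq_zero_iff_of_nonpos hle).mp hdsum i (Finset.mem_univ i)
    apply hi
    simp only [hd] at this
    omega
  obtain ⟨D, hD⟩ := Int.eq_ofNat_of_zero_le (show 0 ≤ d i₀ by omega)
  have hDv : D + 2 ≤ v := by
    have := hdeg i₀
    simp only [hd] at hD
    omega
  -- `e i` measures the parallel edges at `i`
  set e : Fin v → ℝ := fun i => (B * B) i i - ∑ j, B i j with he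
  have hBB : ∀ i, (B * B) i i = ∑ j, B i j ^ 2 := fun i => by
    simp only [Matrix.mul_apply, hB, Matrix.map_apply]
    exact Finset.sum_congr rfl fun j _ => by rw [hsym j i]; ring
  have he0 : ∀ i, 0 ≤ e i := fun i => by
    rw [he]; dsimp only; rw [hBB, ← Finset.sum_sub_distrib]
    refine Finset.sum_nonneg fun j _ => ?_
    rw [sub_nonneg, hB, Matrix.map_apply]
    exact_mod_cast Nat.le_self_pow two_ne_zero _
  have hrow : ∀ i, ∑ j, B i j = (d i : ℝ) + 2 := fun i => by
    simp [hd, hB]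
  have hM : L + (-2 : ℝ) • (1 : Matrix (Fin v) (Fin v) ℝ)
      = Matrix.diagonal (fun i => (d i : ℝ)) - B := by
    rw [hLA, Matrix.smul_one_eq_diagonal, sub_add_eq_add_sub, Matrix.diagonal_add]
    congr 2; ext i; simp [hd]; ring
  have hdsumR : ∑ i, (d i : ℝ) = 0 := by exact_mod_cast hdsum
  set S := ∑ i, (d i : ℝ) ^ 2 with hS
  set E := ∑ i, e i with hE
  have hE0 : 0 ≤ E := Finset.sum_nonneg fun i _ => he0 i
  have hq : ∀ i, (B * B) i i = e i + d i + 2 := fun i => by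
    have := hrow i; simp only [he]; linarith
  have h1 : ∑ i, (hL.eigenvalues i + -2) = 0 := by
    have := hL.trace_add_smul_one_pow (-2) 1
    simp only [pow_one] at this
    rw [← this, hM, Matrix.trace_sub, Matrix.trace_diagonal, hdsumR]
    simp [Matrix.trace, hB0]
  have h2 : ∑ i, (hL.eigenvalues i + -2) ^ 2 = 2 * v + (S + E) := by
    rw [← hL.trace_add_smul_one_pow (-2) 2, hM, trace_diagonal_sub_sq _ _ hB0]
    simp only [hq, Finset.sum_add_distrib, hdsumR]
    simp [hS, hE]; ring
  have hDR : ∀ i, (d i : ℝ) ≤ D := fun i => by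
    have := hmax i (Finset.mem_univ i)
    rw [hD] at this
    exact_mod_cast this
  have h1D : (1 : ℝ) ≤ D := by
    have : (1 : ℤ) ≤ D := by rw [hD] at hD1; exact hD1
    exact_mod_cast this
  -- `d³ - d = (d - 1) (d² + d)`, where `d² + d ≥ 0` for integers, and `∑ d = 0`
  have hcube : ∑ i, (d i : ℝ) ^ 3 ≤ (D - 1) * S := by
    have hi : ∀ i, (d i : ℝ) ^ 3 ≤ (D - 1) * ((d i : ℝ) ^ 2 + d i) + d i := fun i => by
      have hnn : 0 ≤ (d i : ℝ) ^ 2 + d i := by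
        have : 0 ≤ d i ^ 2 + d i := by
          rcases le_or_gt 0 (d i) with h | h <;> nlinarith
        exact_mod_cast this
      nlinarith [mul_nonneg (sub_nonneg.mpr (hDR i)) hnn]
    refine (Finset.sum_le_sum fun i _ => hi i).trans (le_of_eq ?_)
    rw [Finset.sum_add_distrib, ← Finset.mul_sum, Finset.sum_add_distrib, hdsumR]
    ring
  have hde : ∑ i, (d i : ℝ) * e i ≤ D * E := by
    rw [hE, Finset.mul_sum]
    exact Finset.sum_le_sum fun i _ => mul_le_mul_of_nonneg_right (hDR i) (he0 i)
  have hS0 : 0 ≤ S := Finset.sum_nonneg fun i _ => sq_nonneg _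
  have h3 : ∑ i, (hL.eigenvalues i + -2) ^ 3 ≤ 3 * D * (S + E) := by
    rw [← hL.trace_add_smul_one_pow (-2) 3, hM, trace_diagonal_sub_cube _ _ hB0]
    -- closed walks of length `3` only lower the third moment
    have htri : 0 ≤ (B * B * B).trace := by
      simp only [Matrix.trace, Matrix.diag, Matrix.mul_apply, hB, Matrix.map_apply]
      positivity
    have hmid : ∑ i, (d i : ℝ) * (B * B) i i = ∑ i, (d i : ℝ) * e i + S := by
      simp only [hq, hS, mul_add, Finset.sum_add_distrib, ← Finset.sum_mul, hdsumR]
      simp [sq]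
    rw [hmid]
    nlinarith
  -- the other excesses add up to `-D`, and `d² ≥ -d` for integers
  have hQ : (D : ℝ) ^ 2 + D ≤ S + E := by
    have hi : ∑ i ∈ Finset.univ.erase i₀, -(d i) ≤ ∑ i ∈ Finset.univ.erase i₀, d i ^ 2 :=
      Finset.sum_le_sum fun i _ => by
        rcases le_or_gt 0 (d i) with h | h <;> nlinarith
    have ha := Finset.add_sum_erase Finset.univ d (Finset.mem_univ i₀)
    have hb := Finset.add_sum_erase Finset.univ (fun i => d i ^ 2) (Finset.mem_univ i₀)
    rw [Finset.sum_neg_distrib] at hi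
    rw [hdsum] at ha
    have : (D : ℤ) ^ 2 + D ≤ ∑ i, d i ^ 2 := by
      simp only [hD] at ha hb; linarith
    have : (D : ℝ) ^ 2 + D ≤ S := by rw [hS]; exact_mod_cast this
    linarith
  have hz : (v : ℝ) + 2 ≤ x + 2 := by linarith
  have hpoly := irregular_polynomial_bound hv (by exact_mod_cast h1D) hDv hQ
  set Q := S + E
  have hQ2 : 2 ≤ Q := by nlinarith
  have hz0 : 0 < x + 2 := by linarith
  have key := sum_one_div_ge_of_moments (s := fun i => hL.eigenvalues i + -2) (z := x + 2)
    (T₃ := ∑ i, (hL.eigenvalues i + -2) ^ 3) (C := (2 * v + 1) / (x + 2)) hz0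
    (fun i => by have := hpos i; linarith) h1 h2 rfl ?_ (by linarith)
  · rw [Fintype.card_fin] at key
    refine key.trans (le_of_eq (Finset.sum_congr rfl fun i _ => ?_))
    congr 1; ring
  · rw [div_mul_eq_mul_div, div_le_iff₀ hz0]
    set T₃ := ∑ i, (hL.eigenvalues i + -2) ^ 3
    have ha : (2 * v + 1) * T₃ ≤ (2 * v + 1) * (3 * D * Q) :=
      mul_le_mul_of_nonneg_left h3 (by linarith)
    have hb : (v + 2) * (2 * v + Q) * (Q - 1) ≤ (x + 2) * (2 * v + Q) * (Q - 1) := by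
      refine mul_le_mul_of_nonneg_right (mul_le_mul_of_nonneg_right hz ?_) ?_ <;> linarith
    nlinarith

/-! ### Periodic second differences and dihedral orbits -/

/-- Summation by parts against `β ^ n + β ^ (k - n)`, which solves the homogeneous recurrence for
`z = β + β⁻¹` away from the ends. It gives the value at one vertex of the Green function of a cycle
of length `k`. -/
lemma sum_mul_second_difference {β : ℝ} (hβ : β ≠ 0) {k : ℕ} (c : ℕ → ℝ) (h0 : c k = c 0)
    (h1 : c (k + 1) = c 1) :
    ∑ n ∈ Finset.range k, (β ^ (n : ℤ) + β ^ ((k : ℤ) - n)) *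
        ((β + β⁻¹) * c (n + 1) - c (n + 2) - c n)
      = c 1 * ((β⁻¹ - β) * (1 - β ^ k)) := by
  have key : ∀ m : ℕ, ∑ n ∈ Finset.range m, (β ^ (n : ℤ) + β ^ ((k : ℤ) - n)) *
        ((β + β⁻¹) * c (n + 1) - c (n + 2) - c n)
      = (β ^ (m : ℤ) + β ^ ((k : ℤ) - m)) * c m - (1 + β ^ (k : ℤ)) * c 0
        - (β ^ (m : ℤ) * β⁻¹ + β ^ ((k : ℤ) - m) * β) * c (m + 1)
        + (β⁻¹ + β ^ (k : ℤ) * β) * c 1 := by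
    intro m
    induction m with
    | zero => simp
    | succ m ih =>
      rw [Finset.sum_range_succ, ih]
      have e1 : β ^ ((m + 1 : ℕ) : ℤ) = β ^ (m : ℤ) * β := by
        push_cast; rw [zpow_add_one₀ hβ]
      have e2 : β ^ ((k : ℤ) - (m + 1 : ℕ)) = β ^ ((k : ℤ) - m) * β⁻¹ := by
        push_cast; rw [← sub_sub, zpow_sub_one₀ hβ]
      rw [e1, e2]
      have hm : m + 1 + 1 = m + 2 := rfl
      rw [hm]
      field_simp
      ring
  rw [key k, sub_self, zpow_zero, h0, h1, zpow_natCast]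
  field_simp
  ring

/-- Two fixed-point-free involutions `σ`, `τ` generate a dihedral group; an orbit of the rotation
`σ τ` is disjoint from its reflection, so that it fills at most half of the set. -/
lemma exists_iterate_eq_of_involutive {Φ : Type*} [Fintype Φ] {σ τ : Φ → Φ}
    (hσ : Function.Involutive σ) (hτ : Function.Involutive τ) (hσ' : ∀ φ, σ φ ≠ φ)
    (hτ' : ∀ φ, τ φ ≠ φ) (φ₀ : Φ) :
    ∃ k, 1 ≤ k ∧ 2 * k ≤ Fintype.card Φ ∧ (σ ∘ τ)^[k] φ₀ = φ₀ := by
  have hinj : Function.Injective (σ ∘ τ) := hσ.injective.comp hτ.injective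
  -- a rotation never agrees with the reflection `τ`: the claim passes from `N` to `N + 2` by
  -- conjugation, hence the two consecutive exponents
  have hne : ∀ (N : ℕ) (φ : Φ), (σ ∘ τ)^[N] φ ≠ τ φ ∧ (σ ∘ τ)^[N + 1] φ ≠ τ φ := by
    intro N
    induction N with
    | zero => exact fun φ => ⟨fun h => hτ' φ h.symm, fun h => hσ' (τ φ) h⟩
    | succ N ih =>
      refine fun φ => ⟨(ih φ).2, fun h => (ih (σ (τ φ))).1 ?_⟩
      rw [Function.iterate_succ_apply', Function.iterate_succ_apply] at h
      simp only [Function.comp_apply] at h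
      have h2 : τ ((σ ∘ τ)^[N] (σ (τ φ))) = σ (τ φ) := (hσ _).symm.trans (congrArg σ h)
      exact (hτ _).symm.trans (congrArg τ h2)
  -- the points `(σ τ)^n φ₀` and `τ (σ τ)^n φ₀` for `n ≤ |Φ| / 2` outnumber `Φ`
  have hlt : Fintype.card Φ < Fintype.card (Fin (Fintype.card Φ / 2 + 1) × Bool) := by
    simp; omega
  obtain ⟨⟨n, s⟩, ⟨m, t⟩, hnm, heq⟩ := Fintype.exists_ne_map_eq_of_card_lt
    (fun p : Fin (Fintype.card Φ / 2 + 1) × Bool =>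
      if p.2 then τ ((σ ∘ τ)^[p.1] φ₀) else (σ ∘ τ)^[p.1] φ₀) hlt
  have hn := n.2
  have hm := m.2
  have period : ∀ n m : ℕ, n < m → m ≤ Fintype.card Φ / 2 → (σ ∘ τ)^[n] φ₀ = (σ ∘ τ)^[m] φ₀ →
      ∃ k, 1 ≤ k ∧ 2 * k ≤ Fintype.card Φ ∧ (σ ∘ τ)^[k] φ₀ = φ₀ := by
    intro n m h1 h2 h
    refine ⟨m - n, by omega, by omega, ?_⟩
    apply hinj.iterate n
    rw [← Function.iterate_add_apply, Nat.add_sub_cancel' h1.le, h]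
  have same : (σ ∘ τ)^[n] φ₀ = (σ ∘ τ)^[m] φ₀ → n ≠ m →
      ∃ k, 1 ≤ k ∧ 2 * k ≤ Fintype.card Φ ∧ (σ ∘ τ)^[k] φ₀ = φ₀ := by
    intro h hne'
    rcases lt_or_gt_of_ne (Fin.val_ne_of_ne hne') with hlt' | hlt'
    · exact period n m hlt' (by omega) h
    · exact period m n hlt' (by omega) h.symm
  have mixed : ∀ n m : ℕ, (σ ∘ τ)^[n] φ₀ ≠ τ ((σ ∘ τ)^[m] φ₀) := by
    intro n m h
    rcases le_total m n with hle | hle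
    · apply (hne (n - m) ((σ ∘ τ)^[m] φ₀)).1
      rw [← Function.iterate_add_apply, Nat.sub_add_cancel hle, h]
    · apply (hne (m - n) ((σ ∘ τ)^[n] φ₀)).1
      rw [← Function.iterate_add_apply, Nat.sub_add_cancel hle, h, hτ]
  cases s <;> cases t <;> simp only [if_true, if_false, Bool.false_eq_true] at heq
  · exact same heq fun h => hnm (by rw [h])
  · exact absurd heq (mixed _ _)
  · exact absurd heq.symm (mixed _ _)
  · exact same (hτ.injective heq) fun h => hnm (by rw [h])

/-! ### Designs with blocks of size two as multigraphs -/

namespace BlockDesign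

variable {v b : ℕ} (d : BlockDesign v b 2)

/-- The treatment of a flag: a pair of a block and one of its two units. -/
def treatment (φ : Fin b × Fin 2) : Fin v := d.assign φ.1 φ.2

/-- The flag at the other end of the block. -/
def flip (φ : Fin b × Fin 2) : Fin b × Fin 2 := (φ.1, φ.2.rev)

/-- The multigraph of a design with blocks of size `2`: `d.adj i j` is the number of flags with
treatment `i` whose block has treatment `j` at its other end. -/
def adj : Matrix (Fin v) (Fin v) ℕ := Matrix.of fun i j =>
  (Finset.univ.filter fun φ => d.treatment φ = i ∧ d.treatment (flip φ) = j).card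

lemma flip_involutive : Function.Involutive (flip : Fin b × Fin 2 → Fin b × Fin 2) :=
  fun φ => by simp [flip]

lemma flip_ne (φ : Fin b × Fin 2) : flip φ ≠ φ := by
  obtain ⟨j, u⟩ := φ
  fin_cases u <;> simp [flip]

lemma adj_symm (i j : Fin v) : d.adj i j = d.adj j i := by
  refine Finset.card_bij (fun φ _ => flip φ) ?_ (fun _ _ _ _ h => flip_involutive.injective h) ?_
  · intro φ hφ
    simp only [Finset.mem_filter, Finset.mem_univ, true_and] at hφ ⊢
    rw [flip_involutive φ]
    exact hφ.symm
  · intro φ hφ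
    refine ⟨flip φ, ?_, flip_involutive φ⟩
    simp only [Finset.mem_filter, Finset.mem_univ, true_and] at hφ ⊢
    rw [flip_involutive φ]
    exact hφ.symm

lemma sum_adj (i : Fin v) :
    ∑ j, d.adj i j = (Finset.univ.filter fun φ => d.treatment φ = i).card := by
  simp only [adj, Matrix.of_apply]
  rw [Finset.card_eq_sum_card_fiberwise (f := fun φ => d.treatment (flip φ)) (t := Finset.univ)
    (fun _ _ => Finset.mem_coe.mpr (Finset.mem_univ _))]
  simp [Finset.filter_filter]

lemma sum_sum_adj : ∑ i, ∑ j, d.adj i j = 2 * b := by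
  simp only [sum_adj]
  rw [← Finset.card_eq_sum_card_fiberwise (f := d.treatment) (t := Finset.univ)
    (fun _ _ => Finset.mem_coe.mpr (Finset.mem_univ _))]
  simp [mul_comm]

variable {d}

lemma IsBinary.treatment_flip_ne (hd : d.IsBinary) (φ : Fin b × Fin 2) :
    d.treatment (flip φ) ≠ d.treatment φ := by
  obtain ⟨j, u⟩ := φ
  intro h
  exact flip_ne (j, u) (Prod.ext rfl (hd j h))

lemma IsBinary.adj_self (hd : d.IsBinary) (i : Fin v) : d.adj i i = 0 := by
  simp only [adj, Matrix.of_apply, Finset.card_eq_zero, Finset.filter_eq_empty_iff]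
  rintro φ - ⟨h1, h2⟩
  exact hd.treatment_flip_ne φ (h2.trans h1.symm)

lemma IsBinary.sum_adj_le (hd : d.IsBinary) (i : Fin v) : ∑ j, d.adj i j ≤ b := by
  rw [sum_adj]
  refine (Finset.card_le_card_of_injOn Prod.fst (fun _ _ => Finset.mem_coe.mpr
    (Finset.mem_univ _)) ?_).trans (Finset.card_fin b).le
  rintro ⟨j, u⟩ h ⟨j', u'⟩ h' (rfl : j = j')
  have h1 := (Finset.mem_filter.mp (Finset.mem_coe.mp h)).2
  have h2 := (Finset.mem_filter.mp (Finset.mem_coe.mp h')).2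
  exact Prod.ext rfl (hd j (h1.trans h2.symm))

variable (d)

lemma incidence_apply (i : Fin v) (j : Fin b) : d.incidence i j =
    (if d.assign j 0 = i then 1 else 0) + (if d.assign j 1 = i then 1 else 0) := by
  rw [incidence, Matrix.of_apply, Finset.card_filter, Fin.sum_univ_two]
  push_cast
  rfl

lemma adj_apply (i i' : Fin v) : (d.adj i i' : ℝ) = ∑ j,
    ((if d.assign j 0 = i then 1 else 0) * (if d.assign j 1 = i' then 1 else 0) +
      (if d.assign j 1 = i then 1 else 0) * (if d.assign j 0 = i' then (1 : ℝ) else 0)) := by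
  rw [adj, Matrix.of_apply, Finset.card_filter, Fintype.sum_prod_type]
  simp only [Fin.sum_univ_two, treatment, flip]
  push_cast
  refine Finset.sum_congr rfl fun j _ => ?_
  change ((if d.assign j 0 = i ∧ d.assign j 1 = i' then (1 : ℕ) else 0 : ℕ) : ℝ)
    + ((if d.assign j 1 = i ∧ d.assign j 0 = i' then (1 : ℕ) else 0 : ℕ) : ℝ) = _
  rw [ite_and, ite_and]
  split_ifs <;> norm_num

lemma replication_apply (i : Fin v) : d.replication i = ((∑ j, d.adj i j : ℕ) : ℝ) := by
  rw [sum_adj, Finset.card_filter, Fintype.sum_prod_type]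
  push_cast
  simp only [replication, incidence_apply, Fin.sum_univ_two]
  rfl

/-- The Laplacian of a design with blocks of size `2` is the Laplacian of its multigraph. -/
lemma laplacian_eq_diagonal_sub_adj : d.laplacian =
    Matrix.diagonal (fun i => ((∑ j, d.adj i j : ℕ) : ℝ)) - d.adj.map (Nat.cast : ℕ → ℝ) := by
  ext i i'
  simp only [laplacian, concurrence, Matrix.sub_apply, Matrix.smul_apply, Matrix.mul_apply,
    Matrix.transpose_apply, Matrix.map_apply, adj_apply, smul_eq_mul, Matrix.diagonal_apply,
    ← replication_apply]
  by_cases h : i = i'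
  · subst h
    simp only [if_true, replication, Finset.mul_sum, incidence_apply, ← Finset.sum_sub_distrib]
    refine Finset.sum_congr rfl fun j _ => ?_
    split_ifs <;> norm_num
  · simp only [h, if_false, mul_zero, zero_sub, neg_inj, incidence_apply]
    refine Finset.sum_congr rfl fun j _ => ?_
    have : ∀ w : Fin v, (if w = i then (1 : ℝ) else 0) * (if w = i' then 1 else 0) = 0 := by
      intro w
      split_ifs with h1 h2
      · exact absurd (h1.symm.trans h2) h
      all_goals simp
    rw [add_mul, mul_add, mul_add, this, this]
    ring

/-- The oriented incidence matrix: block `j` is the edge from its unit `0` to its unit `1`. -/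
def orientedIncidence : Matrix (Fin v) (Fin b) ℝ := Matrix.of fun i j =>
  (if d.assign j 0 = i then 1 else 0) - (if d.assign j 1 = i then 1 else 0)

lemma laplacian_eq_mul_transpose :
    d.laplacian = d.orientedIncidence * d.orientedIncidence.transpose := by
  rw [laplacian_eq_diagonal_sub_adj]
  ext i i'
  simp only [Matrix.sub_apply, Matrix.diagonal_apply, Matrix.map_apply, adj_apply,
    ← replication_apply, replication, incidence_apply, Matrix.mul_apply, Matrix.transpose_apply,
    orientedIncidence, Matrix.of_apply]
  have h : (if i = i' then ∑ j, ((if d.assign j 0 = i then (1 : ℝ) else 0)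
      + if d.assign j 1 = i then 1 else 0) else 0)
      = ∑ j, if i = i' then ((if d.assign j 0 = i then (1 : ℝ) else 0)
        + if d.assign j 1 = i then 1 else 0) else 0 := by
    split_ifs <;> simp
  rw [h, ← Finset.sum_sub_distrib]
  refine Finset.sum_congr rfl fun j _ => ?_
  by_cases hii : i = i'
  · subst hii
    rw [if_pos rfl]
    split_ifs <;> norm_num
  · have : ∀ w : Fin v, (if w = i then (1 : ℝ) else 0) * (if w = i' then 1 else 0) = 0 := by
      intro w
      split_ifs with h1 h2
      · exact absurd (h1.symm.trans h2) hii
      all_goals simp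
    rw [if_neg hii, sub_mul, mul_sub, mul_sub, this, this]
    ring

lemma posSemidef_laplacian : d.laplacian.PosSemidef := by
  rw [laplacian_eq_mul_transpose]
  simpa using Matrix.posSemidef_self_mul_conjTranspose d.orientedIncidence

lemma sum_laplacian (i : Fin v) : ∑ j, d.laplacian i j = 0 := by
  simp [laplacian_eq_diagonal_sub_adj, Matrix.diagonal_apply]

/-- The Laplacian operator, summed over flags. -/
lemma laplacian_mulVec (g : Fin v → ℝ) (i : Fin v) : (d.laplacian.mulVec g) i =
    ∑ φ ∈ Finset.univ.filter fun φ => d.treatment φ = i, (g i - g (d.treatment (flip φ))) := by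
  rw [laplacian_eq_diagonal_sub_adj, Matrix.sub_mulVec, Pi.sub_apply, Matrix.mulVec_diagonal,
    Finset.sum_sub_distrib, Finset.sum_const, ← sum_adj, nsmul_eq_mul]
  congr 1
  rw [← Finset.sum_fiberwise _ (fun φ => d.treatment (flip φ))]
  simp only [Matrix.mulVec, dotProduct, Matrix.map_apply]
  refine Finset.sum_congr rfl fun j _ => ?_
  rw [Finset.filter_filter, Finset.sum_congr rfl (g := fun _ => g j)
    (fun φ hφ => by rw [(Finset.mem_filter.mp hφ).2.2]), Finset.sum_const, nsmul_eq_mul]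
  rfl

end BlockDesign

/-! ### Green functions of regular designs and of the cycle -/

namespace BlockDesign

lemma exists_add_smul_one_mul_eq_one {v b : ℕ} (d : BlockDesign v b 2) {x : ℝ} (hx : 0 < x) :
    ∃ G, (d.laplacian + x • (1 : Matrix (Fin v) (Fin v) ℝ)) * G = 1 := by
  have h : (d.laplacian + x • (1 : Matrix (Fin v) (Fin v) ℝ)).PosDef :=
    Matrix.PosDef.posSemidef_add d.posSemidef_laplacian (Matrix.PosDef.one.smul hx)
  exact ⟨_, Matrix.mul_nonsing_inv _ ((Matrix.isUnit_iff_isUnit_det _).mp h.isUnit)⟩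

/-- In a `2`-regular design with `b` blocks, walking along the cycle through `u`, which closes up
after at most `b` steps, bounds the Green function at `u` from below. -/
lemma green_ge_of_regular {v b : ℕ} {d : BlockDesign v b 2}
    (hreg : ∀ i, ∑ j, d.adj i j = 2) {β : ℝ} (h0 : 0 < β) (h1 : β < 1)
    {G : Matrix (Fin v) (Fin v) ℝ}
    (hG : (d.laplacian + (β + β⁻¹ - 2) • (1 : Matrix (Fin v) (Fin v) ℝ)) * G = 1) (u : Fin v) :
    (1 + β ^ b) / ((β⁻¹ - β) * (1 - β ^ b)) ≤ G u u := by
  -- `τ φ` is the other flag with the treatment of `φ`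
  have hex : ∀ φ, ∃ φ', φ' ≠ φ ∧ Finset.univ.filter (fun ψ => d.treatment ψ = d.treatment φ)
      = {φ, φ'} := by
    intro φ
    have hc := hreg (d.treatment φ)
    rw [sum_adj, Finset.card_eq_two] at hc
    obtain ⟨x, y, hxy, hs⟩ := hc
    have hφ : φ ∈ ({x, y} : Finset (Fin b × Fin 2)) := by rw [← hs]; simp
    rw [Finset.mem_insert, Finset.mem_singleton] at hφ
    rcases hφ with rfl | rfl
    · exact ⟨y, hxy.symm, hs⟩
    · exact ⟨x, hxy, by rw [hs, Finset.pair_comm]⟩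
  choose τ hτne hτ using hex
  have hττ : ∀ φ, d.treatment (τ φ) = d.treatment φ := fun φ => by
    have : τ φ ∈ Finset.univ.filter (fun ψ => d.treatment ψ = d.treatment φ) := by
      rw [hτ]; simp
    exact (Finset.mem_filter.mp this).2
  have hτinv : Function.Involutive τ := fun φ => by
    have : τ (τ φ) ∈ Finset.univ.filter (fun ψ => d.treatment ψ = d.treatment φ) := by
      simp [hττ]
    rw [hτ, Finset.mem_insert, Finset.mem_singleton] at this
    exact this.resolve_right (hτne _)
  obtain ⟨ψ, hψ⟩ : ∃ ψ, d.treatment ψ = u := by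
    have : 0 < (Finset.univ.filter fun φ => d.treatment φ = u).card := by
      rw [← sum_adj, hreg]; norm_num
    obtain ⟨ψ, hψ⟩ := Finset.card_pos.mp this
    exact ⟨ψ, (Finset.mem_filter.mp hψ).2⟩
  -- the walk reaches `u` at its step `1`
  set φ₀ := τ (flip ψ) with hφ₀
  obtain ⟨k, hk1, hkb, hk⟩ :=
    exists_iterate_eq_of_involutive flip_involutive hτinv flip_ne hτne φ₀
  have hkb' : k ≤ b := by
    simp at hkb; omega
  set g : Fin v → ℝ := fun i => G i u with hg
  have hgreen : ∀ φ, (β + β⁻¹) * g (d.treatment φ) - g (d.treatment (flip (τ φ)))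
      - g (d.treatment (flip φ)) = if d.treatment φ = u then 1 else 0 := by
    intro φ
    have h := congrFun (congrFun hG (d.treatment φ)) u
    rw [add_mul, Matrix.add_apply, Matrix.smul_mul, Matrix.one_mul, Matrix.smul_apply,
      Matrix.one_apply] at h
    have h2 : (d.laplacian * G) (d.treatment φ) u = (d.laplacian.mulVec g) (d.treatment φ) := rfl
    rw [h2, laplacian_mulVec, hτ, Finset.sum_pair (hτne φ).symm, smul_eq_mul] at h
    rw [← h]; ring
  set c : ℕ → ℝ := fun n => g (d.treatment ((flip ∘ τ)^[n] φ₀)) with hc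
  have hper : ∀ n, c (n + k) = c n := fun n => by
    simp only [hc, Function.iterate_add_apply, hk]
  have hstep : ∀ n, (β + β⁻¹) * c (n + 1) - c (n + 2) - c n
      = if d.treatment ((flip ∘ τ)^[n + 1] φ₀) = u then 1 else 0 := by
    intro n
    have h := hgreen ((flip ∘ τ)^[n + 1] φ₀)
    rw [← h]
    have e1 : c (n + 2) = g (d.treatment (flip (τ ((flip ∘ τ)^[n + 1] φ₀)))) := by
      simp only [hc, Function.iterate_succ_apply', Function.comp_apply]
    have e2 : c n = g (d.treatment (flip ((flip ∘ τ)^[n + 1] φ₀))) := by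
      simp only [hc, Function.iterate_succ_apply', Function.comp_apply, flip_involutive _, hττ]
    rw [e1, e2]
  have hsum := sum_mul_second_difference h0.ne' c (by simpa using hper 0)
    (by rw [add_comm]; exact hper 1)
  have hφ1 : (flip ∘ τ)^[0 + 1] φ₀ = ψ := by
    simp [hφ₀, hτinv _, flip_involutive _]
  have hc1 : c 1 = G u u := by
    simp only [hc]; rw [← zero_add 1, hφ1, hψ]
  -- every visit to `u` contributes a nonnegative term; keep the one at the start
  have hlow : 1 + β ^ k ≤ ∑ n ∈ Finset.range k, (β ^ (n : ℤ) + β ^ ((k : ℤ) - n)) *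
        ((β + β⁻¹) * c (n + 1) - c (n + 2) - c n) := by
    have hterm : 1 + β ^ k = (β ^ ((0 : ℕ) : ℤ) + β ^ ((k : ℤ) - (0 : ℕ))) *
        ((β + β⁻¹) * c (0 + 1) - c (0 + 2) - c 0) := by
      rw [hstep, hφ1, if_pos hψ]; simp
    rw [hterm]
    refine Finset.single_le_sum (f := fun n : ℕ => (β ^ (n : ℤ) + β ^ ((k : ℤ) - n)) *
        ((β + β⁻¹) * c (n + 1) - c (n + 2) - c n)) (fun n _ => ?_)
      (Finset.mem_range.mpr (by omega))
    rw [hstep]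
    split_ifs <;> positivity
  rw [hsum, hc1] at hlow
  have hinv : 1 < β⁻¹ := (one_lt_inv₀ h0).mpr h1
  have hβ : 0 < β⁻¹ - β := by linarith
  have hbk : β ^ b ≤ β ^ k := pow_le_pow_of_le_one h0.le h1.le hkb'
  have hk1' : β ^ k < 1 := pow_lt_one₀ h0.le h1 (by omega)
  have hGu : 0 ≤ G u u := by
    by_contra hneg
    have : 0 < (β⁻¹ - β) * (1 - β ^ k) := mul_pos hβ (by linarith)
    nlinarith [pow_pos h0 k]
  rw [div_le_iff₀ (mul_pos hβ (by linarith))]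
  have : G u u * ((β⁻¹ - β) * (1 - β ^ k)) ≤ G u u * ((β⁻¹ - β) * (1 - β ^ b)) :=
    mul_le_mul_of_nonneg_left (mul_le_mul_of_nonneg_left (by linarith) hβ.le) hGu
  linarith

/-- The cycle as a block design: block `j` holds the treatments `j` and `j + 1`. -/
def cycleDesign (n : ℕ) : BlockDesign (n + 3) (n + 3) 2 where
  assign j := ![j, j + 1]

variable (n : ℕ)

lemma cycleDesign_isBinary : (cycleDesign n).IsBinary := by
  intro j
  have h : j ≠ j + 1 := by simp
  intro a b hab
  fin_cases a <;> fin_cases b <;> simp [cycleDesign] at hab ⊢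

lemma cycleDesign_adj (i i' : Fin (n + 3)) : ((cycleDesign n).adj i i' : ℝ) =
    (if i' = i + 1 then 1 else 0) + (if i' = i - 1 then 1 else 0) := by
  rw [adj_apply]
  simp only [cycleDesign, Matrix.cons_val_zero, Matrix.cons_val_one, Finset.sum_add_distrib]
  congr 1
  · rw [Finset.sum_eq_single i (fun j _ hj => by simp [hj]) (by simp)]
    simp [eq_comm]
  · rw [Finset.sum_eq_single i' (fun j _ hj => by simp [hj]) (by simp)]
    simp only [eq_sub_iff_add_eq, if_true, mul_one]
    by_cases h : i' + 1 = i <;> simp only [h, if_true, if_false]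

lemma sum_cycleDesign_adj (i : Fin (n + 3)) : ∑ j, (cycleDesign n).adj i j = 2 := by
  have : ((∑ j, (cycleDesign n).adj i j : ℕ) : ℝ) = 2 := by
    push_cast
    simp only [cycleDesign_adj, Finset.sum_add_distrib, Finset.sum_ite_eq', Finset.mem_univ,
      if_true]
    norm_num
  exact_mod_cast this

lemma cycleDesign_succ_ne_pred (i : Fin (n + 3)) : i + 1 ≠ i - 1 := by
  intro h
  have h2 : (1 : Fin (n + 3)) + 1 = 0 := by
    have h3 : i + 1 + 1 = i := by rw [h, sub_add_cancel]
    rwa [add_assoc, add_eq_left] at h3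
  have h4 := congrArg Fin.val h2
  simp only [Fin.val_add, Fin.val_one, Fin.val_zero] at h4
  rw [Nat.mod_eq_of_lt (by omega)] at h4
  omega

/-- The concrete design stands in for the Laplacian of the cycle graph. -/
lemma laplacian_cycleDesign :
    (cycleDesign n).laplacian = (SimpleGraph.cycleGraph (n + 3)).lapMatrix ℝ := by
  rw [laplacian_eq_diagonal_sub_adj, SimpleGraph.lapMatrix, SimpleGraph.degMatrix]
  congr 1
  · congr 1; ext i
    rw [sum_cycleDesign_adj, SimpleGraph.cycleGraph_degree_three_le]
  · ext i i'
    rw [Matrix.map_apply, cycleDesign_adj, SimpleGraph.adjMatrix_apply]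
    have hadj : (SimpleGraph.cycleGraph (n + 3)).Adj i i' ↔ i' = i + 1 ∨ i' = i - 1 := by
      rw [← SimpleGraph.mem_neighborSet, SimpleGraph.cycleGraph_neighborSet]
      simp [or_comm]
    simp only [hadj]
    have := cycleDesign_succ_ne_pred n i
    by_cases h1 : i' = i + 1
    · subst h1; simp [this]
    · simp [h1]

open Fin.CommRing in
/-- On the cycle itself the walk meets `u` exactly once in `n + 3` steps, so that the bound of
`green_ge_of_regular` is attained. -/
lemma green_cycleDesign {β : ℝ} (h0 : 0 < β) (h1 : β < 1)
    {G : Matrix (Fin (n + 3)) (Fin (n + 3)) ℝ}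
    (hG : ((cycleDesign n).laplacian
      + (β + β⁻¹ - 2) • (1 : Matrix (Fin (n + 3)) (Fin (n + 3)) ℝ)) * G = 1) (u : Fin (n + 3)) :
    G u u = (1 + β ^ (n + 3)) / ((β⁻¹ - β) * (1 - β ^ (n + 3))) := by
  set g : Fin (n + 3) → ℝ := fun i => G i u with hg
  have hgreen : ∀ i, (β + β⁻¹) * g i - g (i + 1) - g (i - 1) = if i = u then 1 else 0 := by
    intro i
    have h := congrFun (congrFun hG i) u
    rw [add_mul, Matrix.add_apply, Matrix.smul_mul, Matrix.one_mul, Matrix.smul_apply,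
      Matrix.one_apply] at h
    have h2 : ((cycleDesign n).laplacian * G) i u = ((cycleDesign n).laplacian.mulVec g) i := rfl
    rw [h2, laplacian_eq_diagonal_sub_adj, Matrix.sub_mulVec, Pi.sub_apply,
      Matrix.mulVec_diagonal, sum_cycleDesign_adj] at h
    have h3 : (((cycleDesign n).adj.map (Nat.cast : ℕ → ℝ)).mulVec g) i = g (i + 1) + g (i - 1) := by
      simp [Matrix.mulVec, dotProduct, cycleDesign_adj, add_mul, Finset.sum_add_distrib]
    rw [h3, smul_eq_mul] at h
    rw [← h]; push_cast; ring
  set c : ℕ → ℝ := fun m => g (u - 1 + (m : Fin (n + 3))) with hc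
  have hstep : ∀ m : ℕ, (β + β⁻¹) * c (m + 1) - c (m + 2) - c m
      = if (m : Fin (n + 3)) = 0 then 1 else 0 := by
    intro m
    have h := hgreen (u - 1 + ((m + 1 : ℕ) : Fin (n + 3)))
    have e1 : u - 1 + ((m + 1 : ℕ) : Fin (n + 3)) + 1 = u - 1 + ((m + 2 : ℕ) : Fin (n + 3)) := by
      push_cast; ring
    have e2 : u - 1 + ((m + 1 : ℕ) : Fin (n + 3)) - 1 = u - 1 + (m : Fin (n + 3)) := by
      push_cast; ring
    have e3 : u - 1 + ((m + 1 : ℕ) : Fin (n + 3)) = u ↔ (m : Fin (n + 3)) = 0 := by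
      push_cast
      rw [show u - 1 + ((m : Fin (n + 3)) + 1) = u + m by ring, add_eq_left]
    rw [e1, e2] at h
    simp only [e3] at h
    exact h
  have hk : ((n + 3 : ℕ) : Fin (n + 3)) = 0 := Fin.natCast_self _
  have hsum := sum_mul_second_difference h0.ne' (k := n + 3) c (by simp only [hc, hk]; simp)
    (by simp only [hc]; rw [Nat.cast_add _ 1, hk, zero_add])
  rw [Finset.sum_eq_single 0] at hsum
  · rw [hstep] at hsum
    have hc1 : c 1 = G u u := by simp [hc, hg]
    rw [hc1] at hsum
    have hinv : 1 < β⁻¹ := (one_lt_inv₀ h0).mpr h1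
    have hk1' : β ^ (n + 3) < 1 := pow_lt_one₀ h0.le h1 (by omega)
    have hne : (β⁻¹ - β) * (1 - β ^ (n + 3)) ≠ 0 :=
      (mul_pos (by linarith) (by linarith)).ne'
    rw [eq_div_iff hne, ← hsum]
    simp only [Nat.cast_zero, if_true, zpow_zero, sub_zero, zpow_natCast, mul_one]
  · intro m hm hm0
    rw [hstep, if_neg, mul_zero]
    intro h
    rw [Fin.natCast_eq_zero] at h
    exact hm0 (Nat.eq_zero_of_dvd_of_lt h (Finset.mem_range.mp hm))
  · simp

end BlockDesign

lemma exists_add_inv_eq {x : ℝ} (hx : 0 < x) : ∃ β : ℝ, 0 < β ∧ β < 1 ∧ β + β⁻¹ - 2 = x := by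
  set s := √((x + 2) ^ 2 - 4) with hs
  have hs2 : s ^ 2 = (x + 2) ^ 2 - 4 := Real.sq_sqrt (by nlinarith)
  have hs0 : 0 ≤ s := Real.sqrt_nonneg _
  have h1 : s < x + 2 := by nlinarith
  have h2 : x < s := by nlinarith
  have hinv : ((x + 2 - s) / 2)⁻¹ = (x + 2 + s) / 2 := by
    refine inv_eq_of_mul_eq_one_right ?_
    linear_combination -hs2 / 4
  refine ⟨(x + 2 - s) / 2, by linarith, by linarith, ?_⟩
  rw [hinv]; ring

/-! ### Comparison of the traces of the resolvents -/

namespace BlockDesign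

/-- The Laplacian eigenvalues of a design with blocks of size `2`, including the trivial one. -/
noncomputable def eigenvalues {v b : ℕ} (d : BlockDesign v b 2) : Fin v → ℝ :=
  d.posSemidef_laplacian.isHermitian.eigenvalues

lemma eigenvalues_nonneg {v b : ℕ} (d : BlockDesign v b 2) (i : Fin v) : 0 ≤ d.eigenvalues i :=
  d.posSemidef_laplacian.eigenvalues_nonneg i

lemma cons_nontrivialEigenvalues_laplacian {v b : ℕ} (hv : 0 < v) (d : BlockDesign v b 2) :
    0 ::ₘ nontrivialEigenvalues d.laplacian = Finset.univ.val.map d.eigenvalues :=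
  d.posSemidef_laplacian.isHermitian.cons_nontrivialEigenvalues hv d.sum_laplacian

lemma nontrivialEigenvalues_nonneg {v b : ℕ} (hv : 0 < v) (d : BlockDesign v b 2) {ρ : ℝ}
    (hρ : ρ ∈ nontrivialEigenvalues d.laplacian) : 0 ≤ ρ := by
  have : ρ ∈ Finset.univ.val.map d.eigenvalues :=
    d.cons_nontrivialEigenvalues_laplacian hv ▸ Multiset.mem_cons_of_mem hρ
  obtain ⟨i, -, rfl⟩ := Multiset.mem_map.mp this
  exact d.eigenvalues_nonneg i

lemma sum_nontrivialEigenvalues {v b : ℕ} (hv : 0 < v) {d : BlockDesign v b 2}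
    (hd : d.IsBinary) : (nontrivialEigenvalues d.laplacian).sum = 2 * b := by
  have h := congrArg Multiset.sum (d.cons_nontrivialEigenvalues_laplacian hv)
  rw [Multiset.sum_cons, zero_add] at h
  have h2 : d.laplacian.trace = ∑ i, d.eigenvalues i :=
    d.posSemidef_laplacian.isHermitian.trace_eq_sum_eigenvalues
  have h3 : d.laplacian.trace = 2 * b := by
    rw [laplacian_eq_diagonal_sub_adj, Matrix.trace_sub, Matrix.trace_diagonal, ← Nat.cast_sum,
      sum_sum_adj]
    simp [Matrix.trace, hd.adj_self]
  rw [h, ← h3, h2]; rfl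

section Cycle

variable (n : ℕ)

lemma cycleDesign_adj_mul (M : Matrix (Fin (n + 3)) (Fin (n + 3)) ℝ) (i k : Fin (n + 3)) :
    ((cycleDesign n).adj.map (Nat.cast : ℕ → ℝ) * M) i k = M (i + 1) k + M (i - 1) k := by
  simp [Matrix.mul_apply, cycleDesign_adj, add_mul, Finset.sum_add_distrib]

lemma laplacian_cycleDesign_sub_two :
    (cycleDesign n).laplacian + (-2 : ℝ) • (1 : Matrix (Fin (n + 3)) (Fin (n + 3)) ℝ)
      = Matrix.diagonal (fun _ => 0) - (cycleDesign n).adj.map (Nat.cast : ℕ → ℝ) := by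
  rw [laplacian_eq_diagonal_sub_adj, Matrix.smul_one_eq_diagonal, sub_add_eq_add_sub,
    Matrix.diagonal_add]
  congr 2; ext i; simp [sum_cycleDesign_adj]

lemma sum_eigenvalues_cycleDesign : ∑ i, ((cycleDesign n).eigenvalues i + -2) = 0 := by
  have h := (cycleDesign n).posSemidef_laplacian.isHermitian.trace_add_smul_one_pow (-2) 1
  simp only [pow_one] at h
  rw [eigenvalues, ← h, laplacian_cycleDesign_sub_two]
  simp [Matrix.trace, (cycleDesign_isBinary n).adj_self]

lemma sum_eigenvalues_cycleDesign_sq :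
    ∑ i, ((cycleDesign n).eigenvalues i + -2) ^ 2 = 2 * ((n + 3 : ℕ) : ℝ) := by
  have h := (cycleDesign n).posSemidef_laplacian.isHermitian.trace_add_smul_one_pow (-2) 2
  rw [eigenvalues, ← h, laplacian_cycleDesign_sub_two, trace_diagonal_sub_sq _ _
    (fun i => by simp [(cycleDesign_isBinary n).adj_self])]
  have h2 : ∀ i : Fin (n + 3), i ≠ i + 1 + 1 ∧ i ≠ i - 1 - 1 := fun i =>
    ⟨fun h => cycleDesign_succ_ne_pred n i (eq_sub_iff_add_eq.mpr h.symm),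
      fun h => cycleDesign_succ_ne_pred n i (eq_sub_iff_add_eq.mp h)⟩
  simp only [cycleDesign_adj_mul, Matrix.map_apply, cycleDesign_adj, (h2 _).1, (h2 _).2,
    add_sub_cancel_right, sub_add_cancel, if_true, if_false]
  simp; ring

/-- A cycle of length at least `4` has no triangle. -/
lemma sum_eigenvalues_cycleDesign_cube (hn : 1 ≤ n) :
    ∑ i, ((cycleDesign n).eigenvalues i + -2) ^ 3 = 0 := by
  have h := (cycleDesign n).posSemidef_laplacian.isHermitian.trace_add_smul_one_pow (-2) 3
  rw [eigenvalues, ← h, laplacian_cycleDesign_sub_two, trace_diagonal_sub_cube _ _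
    (fun i => by simp [(cycleDesign_isBinary n).adj_self]), Matrix.trace]
  have h1 : ∀ i : Fin (n + 3), i ≠ i + 1 := fun i => by simp
  have h1' : ∀ i : Fin (n + 3), i ≠ i - 1 := fun i h => h1 i (eq_sub_iff_add_eq.mp h).symm
  have h3 : ∀ i : Fin (n + 3), i ≠ i + 1 + 1 + 1 := fun i hi => by
    rw [add_assoc, add_assoc, left_eq_add] at hi
    have h4 := congrArg Fin.val hi
    have h5 : ((1 : Fin (n + 3)) + 1).val = 2 := by
      rw [Fin.val_add, Fin.val_one, Nat.mod_eq_of_lt (by omega)]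
    rw [Fin.val_add, h5, Fin.val_one, Fin.val_zero, Nat.mod_eq_of_lt (by omega)] at h4
    omega
  have h3' : ∀ i : Fin (n + 3), i ≠ i - 1 - 1 - 1 := fun i hi =>
    h3 i (by
      have := eq_sub_iff_add_eq.mp (eq_sub_iff_add_eq.mp (eq_sub_iff_add_eq.mp hi))
      exact this.symm)
  simp only [Matrix.diag_apply, mul_assoc, cycleDesign_adj_mul, Matrix.map_apply, cycleDesign_adj,
    add_sub_cancel_right, sub_add_cancel, h1, h1', h3, h3', if_false]
  simp

/-- Gershgorin's theorem for rows with diagonal entry `2` and two off-diagonal entries `-1`. -/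
lemma abs_eigenvalues_cycleDesign_le (i : Fin (n + 3)) :
    |(cycleDesign n).eigenvalues i + -2| ≤ 2 := by
  have hs := (cycleDesign n).posSemidef_laplacian.isHermitian.eigenvalues_mem_spectrum_real i
  rw [← Matrix.spectrum_toLin', ← Module.End.hasEigenvalue_iff_mem_spectrum] at hs
  obtain ⟨k, hk⟩ := eigenvalue_mem_ball hs
  rw [Metric.mem_closedBall, Real.dist_eq] at hk
  have h1 : (cycleDesign n).laplacian k k = 2 := by
    rw [laplacian_eq_diagonal_sub_adj]
    simp [sum_cycleDesign_adj, (cycleDesign_isBinary n).adj_self]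
  have h2 : ∑ j ∈ Finset.univ.erase k, ‖(cycleDesign n).laplacian k j‖ = 2 := by
    have h3 : ∀ j ∈ Finset.univ.erase k, ‖(cycleDesign n).laplacian k j‖
        = ((cycleDesign n).adj k j : ℝ) := fun j hj => by
      rw [laplacian_eq_diagonal_sub_adj, Matrix.sub_apply,
        Matrix.diagonal_apply_ne _ (Finset.ne_of_mem_erase hj).symm]
      simp
    rw [Finset.sum_congr rfl h3, ← Nat.cast_sum, Finset.sum_erase _
      ((cycleDesign_isBinary n).adj_self k), sum_cycleDesign_adj]
    norm_num
  rw [h1, h2] at hk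
  exact hk

open Fin.CommRing in
lemma prod_nontrivialEigenvalues_cycleDesign :
    (nontrivialEigenvalues (cycleDesign n).laplacian).prod = ((n + 3 : ℕ) : ℝ) ^ 2 := by
  rw [laplacian_eq_mul_transpose, prod_nontrivialEigenvalues_eq
    (fun j => (cycleDesign n).assign j 0) (fun j => (cycleDesign n).assign j 1)
    (Q := (cycleDesign n).orientedIncidence) (fun _ _ => rfl)]
  · push_cast; ring
  · intro w hw e he
    have hstep : ∀ i, w i = w (i - 1) := by
      intro i
      have h := congrFun hw i
      simp only [Matrix.mulVec, dotProduct, orientedIncidence, Matrix.of_apply, sub_mul,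
        Finset.sum_sub_distrib, cycleDesign, Matrix.cons_val_zero, Matrix.cons_val_one,
        ← eq_sub_iff_add_eq, Pi.zero_apply] at h
      rw [sub_eq_zero] at h
      rw [Finset.sum_eq_single i (fun j _ hj => by simp [hj]) (by simp),
        Finset.sum_eq_single (i - 1) (fun j _ hj => by simp [hj]) (by simp)] at h
      simpa using h
    have hall : ∀ m : ℕ, w (e + m • 1) = 0 := by
      intro m
      induction m with
      | zero => simpa using he
      | succ m ih =>
        rw [hstep, succ_nsmul, ← add_assoc, add_sub_cancel_right, ih]
    ext i
    have := hall (i - e).val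
    rwa [nsmul_one, Fin.cast_val_eq_self, add_sub_cancel] at this

end Cycle

lemma prod_nontrivialEigenvalues_laplacian_le {n : ℕ} (d : BlockDesign (n + 1) (n + 1) 2) :
    (nontrivialEigenvalues d.laplacian).prod ≤ ((n + 1 : ℕ) : ℝ) ^ 2 := by
  rw [laplacian_eq_mul_transpose]
  have := prod_nontrivialEigenvalues_le
    (fun j => d.assign j 0) (fun j => d.assign j 1) (Q := d.orientedIncidence) (fun _ _ => rfl)
  push_cast
  exact this

lemma sum_one_div_add_eigenvalues {v b : ℕ} (hv : 0 < v) (d : BlockDesign v b 2) (x : ℝ) :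
    ∑ i, 1 / (x + d.eigenvalues i)
      = 1 / x + ((nontrivialEigenvalues d.laplacian).map fun ρ => 1 / (x + ρ)).sum := by
  have h := congrArg (fun s => (s.map fun ρ => 1 / (x + ρ)).sum)
    (d.cons_nontrivialEigenvalues_laplacian hv)
  simp only [Multiset.map_cons, Multiset.sum_cons, add_zero, Multiset.map_map] at h
  rw [h]; rfl

lemma prod_add_eigenvalues {v b : ℕ} (hv : 0 < v) (d : BlockDesign v b 2) (x : ℝ) :
    ∏ i, (x + d.eigenvalues i)
      = x * ((nontrivialEigenvalues d.laplacian).map fun ρ => x + ρ).prod := by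
  have h := congrArg (fun s => (s.map fun ρ => x + ρ).prod)
    (d.cons_nontrivialEigenvalues_laplacian hv)
  simp only [Multiset.map_cons, Multiset.prod_cons, add_zero, Multiset.map_map] at h
  rw [h]; rfl

/-- Among the designs with three treatments the triangle has its two non-trivial eigenvalues
equal. -/
lemma sum_one_div_cycleDesign_le_of_three {d : BlockDesign 3 3 2} (hd : d.IsBinary) {x : ℝ}
    (hx : 0 < x) :
    ∑ i, 1 / (x + (cycleDesign 0).eigenvalues i) ≤ ∑ i, 1 / (x + d.eigenvalues i) := by
  have pair : ∀ {d : BlockDesign 3 3 2}, d.IsBinary → ∃ p q : ℝ, 0 ≤ p ∧ 0 ≤ q ∧ p + q = 6 ∧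
      nontrivialEigenvalues d.laplacian = {p, q} := by
    intro d hd
    have hc := d.cons_nontrivialEigenvalues_laplacian (by norm_num)
    have hcard : (nontrivialEigenvalues d.laplacian).card = 2 := by
      simpa using congrArg Multiset.card hc
    obtain ⟨p, q, hpq⟩ := Multiset.card_eq_two.mp hcard
    have hsum := sum_nontrivialEigenvalues (by norm_num) hd
    refine ⟨p, q, d.nontrivialEigenvalues_nonneg (by norm_num) (by simp [hpq]),
      d.nontrivialEigenvalues_nonneg (by norm_num) (by simp [hpq]), ?_, hpq⟩
    rw [hpq] at hsum
    simp at hsum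
    linarith
  obtain ⟨p, q, hp, hq, hs, hN⟩ := pair hd
  obtain ⟨p', q', -, -, hs', hN'⟩ := pair (cycleDesign_isBinary 0)
  have hprod := prod_nontrivialEigenvalues_cycleDesign 0
  rw [hN'] at hprod
  simp at hprod
  have h3 : p' = 3 := by nlinarith [sq_nonneg (p' - 3)]
  have h3' : q' = 3 := by linarith
  rw [sum_one_div_add_eigenvalues (by norm_num), sum_one_div_add_eigenvalues (by norm_num), hN,
    hN', h3, h3']
  simp only [Multiset.insert_eq_cons, Multiset.map_cons, Multiset.map_singleton,
    Multiset.sum_cons, Multiset.sum_singleton]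
  refine add_le_add_right ?_ _
  rw [div_add_div _ _ (by positivity) (by positivity), div_add_div _ _ (by positivity)
    (by positivity), div_le_div_iff₀ (by positivity) (by positivity)]
  have hq' : q = 6 - p := by linarith
  subst hq'
  nlinarith [sq_nonneg (p - 3), mul_nonneg hx.le (sq_nonneg (p - 3))]

/-- For every real `x ≥ v`, the cycle minimizes the trace of `(x + L)⁻¹` among the multigraphs
with `v` vertices and `v` edges. -/
theorem sum_one_div_cycleDesign_le {n : ℕ} {d : BlockDesign (n + 3) (n + 3) 2} (hd : d.IsBinary)
    {x : ℝ} (hx : ((n + 3 : ℕ) : ℝ) ≤ x) :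
    ∑ i, 1 / (x + (cycleDesign n).eigenvalues i) ≤ ∑ i, 1 / (x + d.eigenvalues i) := by
  have hn0 : (0 : ℝ) ≤ n := Nat.cast_nonneg n
  have hx0 : 0 < x := by push_cast at hx; linarith
  by_cases hreg : ∀ i, ∑ j, d.adj i j = 2
  · obtain ⟨β, h0, h1, rfl⟩ := exists_add_inv_eq hx0
    obtain ⟨G, hG⟩ := d.exists_add_smul_one_mul_eq_one hx0
    obtain ⟨H, hH⟩ := (cycleDesign n).exists_add_smul_one_mul_eq_one hx0
    rw [eigenvalues, eigenvalues, ← Matrix.IsHermitian.trace_eq_sum_one_div _ (fun i =>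
      (add_pos_of_pos_of_nonneg hx0 (eigenvalues_nonneg _ i)).ne') hG,
      ← Matrix.IsHermitian.trace_eq_sum_one_div _ (fun i =>
      (add_pos_of_pos_of_nonneg hx0 (eigenvalues_nonneg _ i)).ne') hH]
    refine Finset.sum_le_sum fun u _ => ?_
    rw [Matrix.diag_apply, Matrix.diag_apply, green_cycleDesign n h0 h1 hH]
    exact green_ge_of_regular hreg h0 h1 hG u
  obtain rfl | hn := Nat.eq_zero_or_pos n
  · exact sum_one_div_cycleDesign_le_of_three hd hx0
  push Not at hreg
  have hlow := sum_one_div_ge_of_irregular (by omega) d.adj hd.adj_self hd.sum_adj_le d.adj_symm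
    d.sum_sum_adj hreg d.posSemidef_laplacian.isHermitian d.laplacian_eq_diagonal_sub_adj
    d.eigenvalues_nonneg hx
  have hup := sum_one_div_le_of_moments (s := fun i => (cycleDesign n).eigenvalues i + -2)
    (z := x + 2) (by linarith) (abs_eigenvalues_cycleDesign_le n) (sum_eigenvalues_cycleDesign n)
    (by simpa using sum_eigenvalues_cycleDesign_sq n) (sum_eigenvalues_cycleDesign_cube n hn)
  rw [Fintype.card_fin] at hup
  have he : ∀ i, x + 2 + ((cycleDesign n).eigenvalues i + -2)
      = x + (cycleDesign n).eigenvalues i := fun i => by ring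
  simp only [he] at hup
  refine hup.trans (le_trans ?_ hlow)
  refine add_le_add_right (div_le_div_of_nonneg_right ?_ (by positivity)) _
  set v : ℝ := ((n + 3 : ℕ) : ℝ) with hv
  have hv4 : 4 ≤ v := by
    rw [hv]; exact_mod_cast (by omega : 4 ≤ n + 3)
  have hz4 : 0 < (x + 2) ^ 2 - 4 := by nlinarith
  -- `8 v ≤ (x + 2)² - 4` because `v (v + 4) ≤ (x + 2)² - 4` and `4 ≤ v`
  have h8 : 8 * v / ((x + 2) * ((x + 2) ^ 2 - 4)) ≤ 1 / (x + 2) := by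
    rw [div_le_div_iff₀ (by positivity) (by positivity)]
    have : 8 * v ≤ (x + 2) ^ 2 - 4 := by nlinarith
    nlinarith
  rw [add_div]
  linarith

end BlockDesign

/-! ### Comparison of the determinants, and optimality -/

namespace BlockDesign

/-- The logarithm of `∏ (x + λᵢ)` of the cycle minus that of any other design tends to `0` at
infinity and is nonincreasing for `x ≥ v`, its derivative being a difference of traces of
resolvents. -/
lemma prod_add_eigenvalues_le {n : ℕ} {d : BlockDesign (n + 3) (n + 3) 2} (hd : d.IsBinary)
    {x : ℝ} (hx : ((n + 3 : ℕ) : ℝ) ≤ x) :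
    ∏ i, (x + d.eigenvalues i) ≤ ∏ i, (x + (cycleDesign n).eigenvalues i) := by
  have hn : (0 : ℝ) < ((n + 3 : ℕ) : ℝ) := by positivity
  have hpos : ∀ (d : BlockDesign (n + 3) (n + 3) 2) {t : ℝ}, ((n + 3 : ℕ) : ℝ) ≤ t → ∀ i,
      0 < t + d.eigenvalues i := fun d t ht i =>
    add_pos_of_pos_of_nonneg (hn.trans_le ht) (d.eigenvalues_nonneg i)
  set F : BlockDesign (n + 3) (n + 3) 2 → ℝ → ℝ := fun d t => ∑ i, Real.log (t + d.eigenvalues i)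
  have hderiv : ∀ (d : BlockDesign (n + 3) (n + 3) 2) {t : ℝ}, ((n + 3 : ℕ) : ℝ) ≤ t →
      HasDerivAt (F d) (∑ i, 1 / (t + d.eigenvalues i)) t := fun d t ht =>
    HasDerivAt.fun_sum fun i _ => ((hasDerivAt_id t).add_const _).log (hpos d ht i).ne'
  have hdiff : ∀ {t : ℝ}, ((n + 3 : ℕ) : ℝ) ≤ t → HasDerivAt (fun t => F (cycleDesign n) t - F d t)
      (∑ i, 1 / (t + (cycleDesign n).eigenvalues i) - ∑ i, 1 / (t + d.eigenvalues i)) t :=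
    fun ht => (hderiv _ ht).sub (hderiv _ ht)
  have hanti : AntitoneOn (fun t => F (cycleDesign n) t - F d t) (Set.Ici ((n + 3 : ℕ) : ℝ)) := by
    refine antitoneOn_of_deriv_nonpos (convex_Ici _)
      (fun t ht => (hdiff ht).continuousAt.continuousWithinAt) (fun t ht => ?_) fun t ht => ?_
    · exact (hdiff (interior_subset ht)).differentiableAt.differentiableWithinAt
    · rw [(hdiff (interior_subset ht)).deriv, sub_nonpos]
      exact sum_one_div_cycleDesign_le hd (interior_subset ht)
  have hlim : Filter.Tendsto (fun t => F (cycleDesign n) t - F d t) Filter.atTop (nhds 0) := by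
    have h : ∀ t, F (cycleDesign n) t - F d t
        = ∑ i, ((Real.log (t + (cycleDesign n).eigenvalues i) - Real.log t)
          - (Real.log (t + d.eigenvalues i) - Real.log t)) := fun t => by
      simp [F, Finset.sum_sub_distrib]
    simp only [h]
    have h0 : (0 : ℝ) = ∑ _i : Fin (n + 3), ((0 : ℝ) - 0) := by simp
    rw [h0]
    exact tendsto_finsetSum _ fun i _ =>
      (Real.tendsto_log_comp_add_sub_log _).sub (Real.tendsto_log_comp_add_sub_log _)
  have hF : 0 ≤ F (cycleDesign n) x - F d x := by
    refine le_of_tendsto hlim ?_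
    filter_upwards [Filter.eventually_ge_atTop x] with t ht
    exact hanti hx (hx.trans ht) ht
  have hlog : ∀ d : BlockDesign (n + 3) (n + 3) 2,
      F d x = Real.log (∏ i, (x + d.eigenvalues i)) := fun d =>
    (Real.log_prod fun i _ => (hpos d hx i).ne').symm
  rw [hlog, hlog, sub_nonneg] at hF
  exact (Real.log_le_log_iff (Finset.prod_pos fun i _ => hpos _ hx i)
    (Finset.prod_pos fun i _ => hpos _ hx i)).mp hF

/-- Off the diagonal the concurrences are the negated Laplacian entries, so that the concurrence
graph contains the cycle. -/
lemma connected_of_laplacian_eq {n b y : ℕ} {d : BlockDesign (n + 3) b 2}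
    (hL : d.laplacian = extendLaplacian ((SimpleGraph.cycleGraph (n + 3)).lapMatrix ℝ) y) :
    d.IsConnected := by
  refine SimpleGraph.cycleGraph_connected.mono fun i j hij => ?_
  have hne : i ≠ j := hij.ne
  have h := congrFun (congrFun hL i) j
  simp only [laplacian, extendLaplacian, SimpleGraph.lapMatrix, SimpleGraph.degMatrix,
    Matrix.sub_apply, Matrix.add_apply, Matrix.smul_apply, Matrix.diagonal_apply_ne _ hne,
    Matrix.one_apply_ne hne, Matrix.of_apply, SimpleGraph.adjMatrix_apply, hij, if_true,
    smul_eq_mul, mul_zero, zero_sub, mul_neg, mul_one] at h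
  have hy : (0 : ℝ) ≤ y := Nat.cast_nonneg y
  rw [concurrenceGraph, SimpleGraph.fromRel_adj]
  exact ⟨hne, Or.inl (by linarith)⟩

/-- The sum of the non-trivial eigenvalues is the trace `2 v`, whatever the binary design. -/
lemma laplacian_mem_maxLaplacians {v : ℕ} (hv : 0 < v) {d : BlockDesign v v 2}
    (hd : d.IsBinary) : d.laplacian ∈ maxLaplacians 1 v v 2 := by
  refine ⟨⟨d, hd, rfl⟩, fun j h1 h2 L' hL' => ?_⟩
  obtain ⟨d', hd', rfl⟩ := hL'
  obtain rfl : j = 1 := le_antisymm h2 h1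
  have h : ∀ d : BlockDesign v v 2, eigenSymm 1 d.laplacian
      = (nontrivialEigenvalues d.laplacian).sum := fun d => by
    simp [eigenSymm, Multiset.esymm, Multiset.powersetCard_one]
  rw [h, h, sum_nontrivialEigenvalues hv hd, sum_nontrivialEigenvalues hv hd']

lemma dValue_eq {v b b' : ℕ} (hv : 0 < v) {d : BlockDesign v b 2} {e : BlockDesign v b' 2} {y : ℕ}
    (h : d.laplacian = extendLaplacian e.laplacian y) :
    d.dValue = ((nontrivialEigenvalues e.laplacian).map fun ρ => (y : ℝ) * v + ρ).prod := by
  rw [dValue, h, nontrivialEigenvalues_extendLaplacian hv e.sum_laplacian]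
  simp only [add_comm]

lemma aValue_eq {v b b' : ℕ} (hv : 0 < v) {d : BlockDesign v b 2} {e : BlockDesign v b' 2} {y : ℕ}
    (h : d.laplacian = extendLaplacian e.laplacian y) :
    d.aValue = ((v : ℝ) - 1) /
      ((nontrivialEigenvalues e.laplacian).map fun ρ => 1 / ((y : ℝ) * v + ρ)).sum := by
  rw [aValue, h, nontrivialEigenvalues_extendLaplacian hv e.sum_laplacian, Multiset.map_map]
  simp only [Function.comp_def, add_comm]

lemma sum_one_div_nontrivialEigenvalues_pos {v b : ℕ} (hv : 1 < v) (d : BlockDesign v b 2)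
    {x : ℝ} (hx : 0 < x) :
    0 < ((nontrivialEigenvalues d.laplacian).map fun ρ => 1 / (x + ρ)).sum := by
  have hcard := congrArg Multiset.card (d.cons_nontrivialEigenvalues_laplacian (by omega))
  simp only [Multiset.card_cons, Multiset.card_map, Finset.card_val, Finset.card_univ,
    Fintype.card_fin] at hcard
  obtain ⟨ρ, hρ⟩ := Multiset.card_pos_iff_exists_mem.mp
    (show 0 < (nontrivialEigenvalues d.laplacian).card by omega)
  have hpos : ∀ ρ ∈ nontrivialEigenvalues d.laplacian, 0 < 1 / (x + ρ) := fun ρ hρ =>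
    one_div_pos.mpr (add_pos_of_pos_of_nonneg hx (d.nontrivialEigenvalues_nonneg (by omega) hρ))
  obtain ⟨s, hs⟩ := Multiset.exists_cons_of_mem hρ
  have hrest : 0 ≤ (s.map fun ρ => 1 / (x + ρ)).sum := by
    refine Multiset.sum_nonneg fun t ht => ?_
    obtain ⟨ρ', hρ', rfl⟩ := Multiset.mem_map.mp ht
    exact (hpos ρ' (by rw [hs]; exact Multiset.mem_cons_of_mem hρ')).le
  rw [hs, Multiset.map_cons, Multiset.sum_cons]
  exact add_pos_of_pos_of_nonneg (hpos ρ hρ) hrest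

end BlockDesign

theorem mainTheorem3 (v : ℕ) (hv : 2 < v) (y b : ℕ) (d : BlockDesign v b 2) (hd : d.IsBinary)
    (hL : d.laplacian = extendLaplacian ((SimpleGraph.cycleGraph v).lapMatrix ℝ) y) :
    d.IsDOptimalAmong
        (fun _ d' => d'.IsConnectedExtension (maxLaplacians 1 v v 2) y) ∧
      (1 ≤ y →
        d.IsAOptimalAmong
          (fun _ d' => d'.IsConnectedExtension (maxLaplacians 1 v v 2) y)) := by
  obtain ⟨n, rfl⟩ : ∃ n, v = n + 3 := ⟨v - 3, by omega⟩
  have hconn := BlockDesign.connected_of_laplacian_eq hL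
  rw [← BlockDesign.laplacian_cycleDesign] at hL
  have hmem : d.IsConnectedExtension (maxLaplacians 1 (n + 3) (n + 3) 2) y :=
    ⟨hd, hconn, _, BlockDesign.laplacian_mem_maxLaplacians (by omega)
      (BlockDesign.cycleDesign_isBinary n), hL⟩
  have hx : 1 ≤ y → ((n + 3 : ℕ) : ℝ) ≤ (y : ℝ) * (n + 3 : ℕ) := fun hy =>
    le_mul_of_one_le_left (Nat.cast_nonneg _) (by exact_mod_cast hy)
  have hn : (0 : ℝ) < ((n + 3 : ℕ) : ℝ) := by positivity
  refine ⟨⟨hmem, ?_⟩, fun hy => ⟨hmem, ?_⟩⟩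
  · rintro b' d' ⟨-, -, L, ⟨⟨e, he, rfl⟩, -⟩, hL'⟩
    rw [BlockDesign.dValue_eq (by omega) hL, BlockDesign.dValue_eq (by omega) hL']
    obtain rfl | hy := Nat.eq_zero_or_pos y
    · simp only [Nat.cast_zero, zero_mul, zero_add, Multiset.map_id']
      rw [BlockDesign.prod_nontrivialEigenvalues_cycleDesign]
      exact e.prod_nontrivialEigenvalues_laplacian_le
    · have h := BlockDesign.prod_add_eigenvalues_le he (hx hy)
      rw [BlockDesign.prod_add_eigenvalues (by omega), BlockDesign.prod_add_eigenvalues (by omega)]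
        at h
      exact le_of_mul_le_mul_left h (hn.trans_le (hx hy))
  · rintro b' d' ⟨-, -, L, ⟨⟨e, he, rfl⟩, -⟩, hL'⟩
    rw [BlockDesign.aValue_eq (by omega) hL, BlockDesign.aValue_eq (by omega) hL']
    have h := BlockDesign.sum_one_div_cycleDesign_le he (hx hy)
    have hC := (BlockDesign.cycleDesign n).sum_one_div_nontrivialEigenvalues_pos (by omega)
      (hn.trans_le (hx hy))
    rw [BlockDesign.sum_one_div_add_eigenvalues (by omega),
      BlockDesign.sum_one_div_add_eigenvalues (by omega)] at h
    refine div_le_div_of_nonneg_left ?_ hC (by linarith)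
    push_cast
    have : (0 : ℝ) ≤ n := Nat.cast_nonneg n
    linarith
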